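/- **Setting.** Let \(\Theta=\{\theta\in\mathbb R^d:\|\theta\|_2=1\}\), \(h_\theta(x)=\mathrm{sign}\langle\theta,x\rangle\in\{-1,1\}\), and \(\ell(x,y;\theta)=\mathbf 1(y\langle\theta,x\rangle\le 0)\). Under \(P_0\) the label is \(y=\pm1\) with probability \(1/2\) each and \(X\mid y\sim\mathcal N(y\mu_0,\sigma_0^2 I)\) with \(\sigma_0>0\); let \(P_{1,X}=\frac12\mathcal N(\mu_1,\sigma_1^2I)+\frac12\mathcal N(-\mu_1,\sigma_1^2I)\) with \(\|\mu_0-\mu_1\|_2\le K\alpha\) and \(|\sigma_1-\sigma_0|\le K\alpha\), where \(K>0\), \(\alpha\ge 0\), \(\sigma_1\ge0\). Let \(S_0=\{(X_i,y_i)\}_{i\le m}\sim P_0^m\) and, independently, \(S_1=\{X'_j\}_{j\le n}\sim P_{1,X}^n\), with \(d,m\ge1\). For a cost \(c\) put \(\phi^{c}_\gamma(x,y;\theta)=\sup_{z\in\mathbb R^d}\{\ell(z,y;\theta)-\gamma c(z,x)\}\). The RSS estimator \(\hat\theta^{\mathrm{RSS}}\) with parameters \(\gamma,\gamma',\lambda\ge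 0\) is a minimizer over \(\theta\in\Theta\) of \[\frac1m\sum_{i=1}^m\phi^{\|\cdot\|_2}_\gamma(X_i,y_i;\theta)+\frac{\lambda}{n}\sum_{j=1}^n\phi^{\|\cdot\|_2^2}_{\gamma'}\big(X'_j,h_\theta(X'_j);\theta\big).\] Let \(R(\theta,P_0)=\mathbb E_{P_0}\,\ell(X,y;\theta)\), and let the excess risk of \(\theta\) be \(R(\theta,P_0)-\min_{\theta'\in\Theta}R(\theta',P_0)\). **Claim.** There is a (measurable) rule that calculates \(\gamma,\gamma',\lambda\) from the samples \(S_0,S_1\) and the confidence level \(\delta\) alone, such that for all \(r\ge 0\), \(\sigma_0>0\), \(K>0\) the following two statements hold whenever \(\|\mu_0\|_2=r\); here "\(\hat\theta^{\mathrm{RSS}}\) has excess risk at most \(b\)" means that a minimizer exists and that every minimizer has excess risk at most \(b\). 1. (Advantage over the ERM bound of order \(\sqrt{d/m}\).) There is \(C>0\) such that for every \(c>0\) there are \(c_1,c_2>0\), all depending only on \(r,\sigma_0,K\) (and \(c_1,c_2\) also on \(c\)), such that for all \(d,m,n,\mu_0,\mu_1,\sigma_1,\alpha\) as above and all \(\delta\in(0,1)\):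 if \(\alpha\le c_1\, d/m\) and \(n\ge c_2\, m^2/d\), then with probability at least \(1-\delta\) the estimator \(\hat\theta^{\mathrm{RSS}}\) has excess risk at most \[c\sqrt{\frac dm}+C\sqrt{\frac{1+\log(1/\delta)}{m}} .\] 2. (Labeled sample size independent of the dimension.) For all \(A,B>0\) there is \(C>0\), depending only on \(r,\sigma_0,K,A,B\), such that for all \(\varepsilon>0\), \(\delta\in(0,1)\) and all \(d,m,n,\mu_0,\mu_1,\sigma_1,\alpha\) as above: if \(\alpha\le A/d\), \(n\ge B d^3\) and \(m\ge C\max\{\varepsilon^{-4},\ \varepsilon^{-2}\log(1/\delta)\}\), then with probability at least \(1-\delta\) the estimator \(\hat\theta^{\mathrm{RSS}}\) has excess risk at most \(\varepsilon\). -/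

import Mathlib

open MeasureTheory ProbabilityTheory
open scoped NNReal ENNReal

namespace RSS

/-- The feature space `ℝ^d` with its Euclidean norm. -/
abbrev E (d : ℕ) : Type := EuclideanSpace ℝ (Fin d)

/-- The parameter set `Θ`: unit normal vectors of linear classifiers. -/
abbrev Theta (d : ℕ) : Set (E d) := Metric.sphere (0 : E d) 1

/-- The linear classifier `h_θ(x) = sign ⟨θ, x⟩ ∈ {-1, 1}`. -/
noncomputable def classify {d : ℕ} (θ x : E d) : ℝ :=
  if 0 ≤ inner ℝ θ x then 1 else -1

/-- The zero-one loss of a labeled point: it is `1` exactly when `y ⟨θ, x⟩ ≤ 0`. -/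
noncomputable def loss {d : ℕ} (x : E d) (y : ℝ) (θ : E d) : ℝ :=
  if y * inner ℝ θ x ≤ 0 then 1 else 0

/-- The transportation cost used for labeled points: the Euclidean distance. -/
noncomputable def cost {d : ℕ} (z x : E d) : ℝ := ‖z - x‖

/-- The transportation cost used for unlabeled points: the squared Euclidean distance. -/
noncomputable def costSq {d : ℕ} (z x : E d) : ℝ := ‖z - x‖ ^ 2

/-- The robust loss `φ_γ(x, y; θ) = sup_z (ℓ(z, y; θ) - γ c(z, x))` for a cost `c`. -/
noncomputable def robustLoss {d : ℕ} (c : E d → E d → ℝ) (γ : ℝ≥0)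
    (x : E d) (y : ℝ) (θ : E d) : ℝ :=
  ⨆ z : E d, (loss z y θ - γ * c z x)

/-- A pair of samples `(S₀, S₁)`: `m` labeled points and `n` unlabeled points. -/
abbrev Samples (d m n : ℕ) : Type := (Fin m → E d × ℝ) × (Fin n → E d)

/-- A choice `(γ, γ', lam)` of the three nonnegative parameters of RSS training. -/
abbrev Params : Type := ℝ≥0 × ℝ≥0 × ℝ≥0

/-- The objective of RSS training with parameters `p = (γ, γ', lam)`: the average robust loss of
the labeled points, plus `lam` times the average robust loss of the unlabeled points with the
labels `h_θ` assigns to them. -/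
noncomputable def objective {d m n : ℕ} (p : Params) (S : Samples d m n) (θ : E d) : ℝ :=
  (1 / m : ℝ) * ∑ i, robustLoss cost p.1 (S.1 i).1 (S.1 i).2 θ +
    ((p.2.2 : ℝ) / n) * ∑ j, robustLoss costSq p.2.1 (S.2 j) (classify θ (S.2 j)) θ

/-- `θ` is an RSS estimator: a minimizer over `Θ` of the RSS objective. -/
def IsRSSEstimator {d m n : ℕ} (p : Params) (S : Samples d m n) (θ : E d) : Prop :=
  θ ∈ Theta d ∧ ∀ θ' ∈ Theta d, objective p S θ ≤ objective p S θ'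

/-- The isotropic Gaussian law `N(μ, σ² I)` on `ℝ^d`. -/
noncomputable def isoGaussian {d : ℕ} (μ : E d) (σ : ℝ) : Measure (E d) :=
  (stdGaussian (E d)).map (fun z => μ + σ • z)

/-- The feature-label law `P₀`: `y = ±1` with probability `1/2` each, and `x` given `y` has
law `N(y μ, σ² I)`. -/
noncomputable def labeledLaw {d : ℕ} (μ : E d) (σ : ℝ) : Measure (E d × ℝ) :=
  (2⁻¹ : ℝ≥0∞) • (isoGaussian μ σ).prod (Measure.dirac (1 : ℝ)) +
    (2⁻¹ : ℝ≥0∞) • (isoGaussian (-μ) σ).prod (Measure.dirac (-1 : ℝ))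

/-- The unlabeled law `P_{1,X} = (1/2) N(μ, σ² I) + (1/2) N(-μ, σ² I)`. -/
noncomputable def unlabeledLaw {d : ℕ} (μ : E d) (σ : ℝ) : Measure (E d) :=
  (2⁻¹ : ℝ≥0∞) • isoGaussian μ σ + (2⁻¹ : ℝ≥0∞) • isoGaussian (-μ) σ

/-- The joint law of `m` i.i.d. labeled points with law `P₀` (parameters `μ₀, σ₀`) and, independently
of them, `n` i.i.d. unlabeled points with law `P_{1,X}` (parameters `μ₁, σ₁`). -/
noncomputable def sampleLaw {d : ℕ} (m n : ℕ) (μ₀ : E d) (σ₀ : ℝ) (μ₁ : E d) (σ₁ : ℝ) :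
    Measure (Samples d m n) :=
  (Measure.pi fun _ : Fin m => labeledLaw μ₀ σ₀).prod
    (Measure.pi fun _ : Fin n => unlabeledLaw μ₁ σ₁)

/-- The (non-robust) risk `R(θ, P) = E_P ℓ(x, y; θ)`. -/
noncomputable def risk {d : ℕ} (P : Measure (E d × ℝ)) (θ : E d) : ℝ :=
  ∫ q, loss q.1 q.2 θ ∂P

/-- The excess risk `R(θ, P) - min_{θ' ∈ Θ} R(θ', P)`. -/
noncomputable def excessRisk {d : ℕ} (P : Measure (E d × ℝ)) (θ : E d) : ℝ :=
  risk P θ - ⨅ θ' : Theta d, risk P (θ' : E d)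

/-- A rule that calculates the parameters `(γ, γ', lam)` of RSS training from the samples, for a
given confidence level `δ`. It sees no parameter of the distributions. -/
abbrev ParamRule : Type := ∀ d m n : ℕ, ℝ → Samples d m n → Params

/-- With probability at least `1 - δ`, RSS training with the parameters calculated by `rule` has a
solution and every solution has excess risk at most `b`. (The exceptional event is measured by
outer measure, so that this is meaningful without a measurability proof.) -/
def ExcessRiskBound {d : ℕ} (rule : ParamRule) (m n : ℕ) (μ₀ : E d) (σ₀ : ℝ) (μ₁ : E d) (σ₁ : ℝ)
    (δ b : ℝ) : Prop :=
  sampleLaw m n μ₀ σ₀ μ₁ σ₁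
    {S | ¬ ((∃ θ, IsRSSEstimator (rule d m n δ S) S θ) ∧
      ∀ θ, IsRSSEstimator (rule d m n δ S) S θ → excessRisk (labeledLaw μ₀ σ₀) θ ≤ b)}
    ≤ ENNReal.ofReal δ

end RSS

namespace RSS

/-! The rule switches between two procedures. With γ = 1 the labeled robust loss is the ramp of the
margin (`robustLoss_cost`). Let θ₀ = μ₀/r and a = ⟨θ, μ₀⟩. The excess risk is at most (r - a)/σ₀
(`excessRisk_le`), so it suffices to bound r - a.

If d³ < m, take λ = 0 and minimize the empirical ramp loss. Its expected excess over θ₀ is at least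
of order r - a, and the variance of the excess is at most of order r - a
(`exists_ramp_excess_deviation`). Bernstein's inequality and a net of scale 1/√m then bound r - a by
the order of (d log m + t)/m + 1/√m, with failure probability of order exp(-t). Since d³ < m, the
dimensional term is O(1/√m), and for t ≤ m the bound becomes √((1 + t)/m) without d
(`exists_low_dimension_bound`).

If m ≤ d³, the choice γ' = 1/q, λ = nq, with q above all squared norms, turns the unlabeled term
into nq - Σ⟨θ, X'ⱼ⟩² (`objective_paramRule_of_le`). The objective is then principal component
analysis perturbed by a labeled term in [0, 1]. The population second moment in direction θ is ⟨θ,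
μ₁⟩² + σ₁², so a minimizer is close to θ₀ or to -θ₀. The unlabeled term is even in θ, so the labeled
term decides between θ and -θ. That needs a test in only one direction and hence no labeled sample
growing with d (`sub_inner_le_of_moments`, `exists_high_dimension_bound`). The error is of order
√((d + t)/n) + 1/n + Kα.

Both claims follow by choosing constants in these two regimes. In the second claim, m ≤ d³ together
with the lower bound on m forces 1/d = O(ε), so A/d and d/n are small. -/

/-! ### Exponential moments and Chernoff bounds for i.i.d. sums. -/

theorem exp_le_one_add_self_add_sq_mul_exp (x : ℝ) :
    Real.exp x ≤ 1 + x + x ^ 2 * Real.exp |x| := by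
  have h1 : 1 ≤ Real.exp |x| := Real.one_le_exp (abs_nonneg x)
  -- For |x| ≤ 1 the Taylor remainder is at most x². For x > 1 the last term alone exceeds exp x,
  -- and for x < -1 the inequality -x ≤ x² absorbs the linear term.
  rcases le_or_gt |x| 1 with h | h
  · have h2 := Real.norm_exp_sub_one_sub_id_le (x := x) (by simpa using h)
    rw [Real.norm_eq_abs, Real.norm_eq_abs, sq_abs] at h2
    have h3 := (abs_le.1 h2).2
    nlinarith [sq_nonneg x]
  · rcases le_total 0 x with h0 | h0
    · rw [abs_of_nonneg h0] at *
      have : 1 ≤ x ^ 2 := by nlinarith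
      nlinarith [Real.exp_pos x]
    · have h2 : Real.exp x ≤ 1 := Real.exp_le_one_iff.2 h0
      rw [abs_of_nonpos h0] at *
      have : -x ≤ x ^ 2 := by nlinarith
      nlinarith [sq_nonneg x]

/-- A Bernstein-type bound of the moment generating function of a centered random variable. -/
theorem integral_exp_mul_le {Ω : Type*} [MeasurableSpace Ω] {P : Measure Ω}
    [IsProbabilityMeasure P] {Y : Ω → ℝ} (hY : Measurable Y) {s s₀ V : ℝ}
    (hi : Integrable Y P) (h0 : ∫ ω, Y ω ∂P = 0)
    (hVi : Integrable (fun ω => Y ω ^ 2 * Real.exp (s₀ * |Y ω|)) P)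
    (hV : ∫ ω, Y ω ^ 2 * Real.exp (s₀ * |Y ω|) ∂P ≤ V) (hs : |s| ≤ s₀) :
    Integrable (fun ω => Real.exp (s * Y ω)) P ∧
      ∫ ω, Real.exp (s * Y ω) ∂P ≤ Real.exp (s ^ 2 * V) := by
  -- The weight exp(s₀|Y|) does not depend on s, so a single moment V serves every |s| ≤ s₀.
  have hb : ∀ ω, Real.exp (s * Y ω) ≤
      1 + s * Y ω + s ^ 2 * (Y ω ^ 2 * Real.exp (s₀ * |Y ω|)) := by
    intro ω
    have h1 := exp_le_one_add_self_add_sq_mul_exp (s * Y ω)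
    have h2 : Real.exp |s * Y ω| ≤ Real.exp (s₀ * |Y ω|) := by
      rw [abs_mul]; gcongr
    nlinarith [mul_le_mul_of_nonneg_left h2 (sq_nonneg (s * Y ω))]
  have hgi : Integrable
      (fun ω => 1 + s * Y ω + s ^ 2 * (Y ω ^ 2 * Real.exp (s₀ * |Y ω|))) P :=
    ((integrable_const 1).add (hi.const_mul s)).add (hVi.const_mul _)
  have hfi : Integrable (fun ω => Real.exp (s * Y ω)) P := by
    refine hgi.mono' (by fun_prop) (ae_of_all _ fun ω => ?_)
    rw [Real.norm_eq_abs, abs_of_pos (Real.exp_pos _)]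
    exact hb ω
  refine ⟨hfi, (integral_mono hfi hgi hb).trans ?_⟩
  have hlin : Integrable (fun ω => 1 + s * Y ω) P := (integrable_const 1).add (hi.const_mul s)
  rw [integral_add hlin (hVi.const_mul _), integral_add (integrable_const 1) (hi.const_mul s), integral_const_mul, integral_const_mul, h0]
  simp only [integral_const, probReal_univ, smul_eq_mul, mul_one, mul_zero, add_zero]
  have h3 := Real.add_one_le_exp (s ^ 2 * V)
  nlinarith [mul_le_mul_of_nonneg_left hV (sq_nonneg s)]

/-- Chernoff's bound for a sum over an i.i.d. sample. -/
theorem pi_measure_sum_ge_le {Ω : Type*} [MeasurableSpace Ω] {P : Measure Ω}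
    [IsProbabilityMeasure P] {Y : Ω → ℝ} {s b u : ℝ} (N : ℕ) (hs : 0 ≤ s)
    (hi : Integrable (fun ω => Real.exp (s * Y ω)) P)
    (hb : ∫ ω, Real.exp (s * Y ω) ∂P ≤ Real.exp b) :
    (Measure.pi fun _ : Fin N => P) {ω | u ≤ ∑ i, Y (ω i)}
      ≤ ENNReal.ofReal (Real.exp (N * b - s * u)) := by
  have hprod : ∀ ω : Fin N → Ω, Real.exp (s * ∑ i, Y (ω i)) = ∏ i, Real.exp (s * Y (ω i)) := by
    intro ω; rw [Finset.mul_sum, Real.exp_sum]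
  have hi2 : Integrable (fun ω : Fin N → Ω => Real.exp (s * ∑ i, Y (ω i)))
      (Measure.pi fun _ : Fin N => P) := by
    simp_rw [hprod]
    exact Integrable.fintype_prod (f := fun _ : Fin N => fun ω => Real.exp (s * Y ω))
      (fun _ => hi)
  have h1 := measure_ge_le_exp_mul_mgf (μ := Measure.pi fun _ : Fin N => P)
    (X := fun ω => ∑ i, Y (ω i)) u hs hi2
  have h2 : mgf (fun ω : Fin N → Ω => ∑ i, Y (ω i)) (Measure.pi fun _ : Fin N => P) s
      ≤ Real.exp (N * b) := by
    unfold mgf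
    simp_rw [hprod]
    rw [integral_fintype_prod_eq_prod (fun _ : Fin N => fun ω => Real.exp (s * Y ω))]
    rw [Finset.prod_const, Finset.card_univ, Fintype.card_fin, Real.exp_nat_mul]
    exact pow_le_pow_left₀ (integral_nonneg fun _ => (Real.exp_pos _).le) hb N
  rw [← ofReal_measureReal]
  apply ENNReal.ofReal_le_ofReal
  refine h1.trans ?_
  rw [show (N * b - s * u : ℝ) = -s * u + N * b by ring, Real.exp_add]
  gcongr

/-- The parameter s stays free below the cap s₀: small deviations call for s proportional to the
deviation, large ones for s = s₀. -/
theorem pi_measure_sum_ge_le_of_bernstein {Ω : Type*} [MeasurableSpace Ω] {P : Measure Ω}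
    [IsProbabilityMeasure P] {Y : Ω → ℝ} (hY : Measurable Y) {s s₀ V : ℝ}
    (hi : Integrable Y P) (h0 : ∫ ω, Y ω ∂P = 0)
    (hVi : Integrable (fun ω => Y ω ^ 2 * Real.exp (s₀ * |Y ω|)) P)
    (hV : ∫ ω, Y ω ^ 2 * Real.exp (s₀ * |Y ω|) ∂P ≤ V) (hs0 : 0 ≤ s) (hs : s ≤ s₀)
    (N : ℕ) (u : ℝ) :
    (Measure.pi fun _ : Fin N => P) {ω | u ≤ ∑ i, Y (ω i)}
      ≤ ENNReal.ofReal (Real.exp (N * (s ^ 2 * V) - s * u)) := by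
  obtain ⟨h1, h2⟩ := integral_exp_mul_le hY hi h0 hVi hV (s := s) (by rwa [abs_of_nonneg hs0])
  exact pi_measure_sum_ge_le N hs0 h1 h2

/-! ### Nets of the unit sphere. -/

section Net

open Metric

/-- Volume comparison: the balls of radius s/2 around the points are disjoint and lie in the ball of
radius 1 + s/2 ≤ 3/2. -/
theorem card_le_of_separated {d : ℕ} {s : ℝ} (hs : 0 < s) (hs1 : s ≤ 1) (T : Finset (E d))
    (hT : ∀ x ∈ T, ‖x‖ = 1) (hsep : ∀ x ∈ T, ∀ y ∈ T, x ≠ y → s < ‖x - y‖) :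
    (T.card : ℝ) ≤ (3 / s) ^ d := by
  classical
  let μ : Measure (E d) := volume
  have hdisj : Set.Pairwise (T : Set (E d)) (Function.onFun Disjoint fun x => ball x (s / 2)) := by
    intro x hx y hy hxy
    apply ball_disjoint_ball
    rw [dist_eq_norm]
    linarith [hsep x hx y hy hxy]
  have hsub : (⋃ x ∈ T, ball x (s / 2)) ⊆ ball (0 : E d) (1 + s / 2) := by
    refine Set.iUnion₂_subset fun x hx => ball_subset_ball' ?_
    rw [dist_zero_right, hT x hx]; linarith
  have h1 : μ (⋃ x ∈ T, ball x (s / 2)) = ∑ x ∈ T, μ (ball x (s / 2)) :=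
    measure_biUnion_finset hdisj fun x _ => measurableSet_ball
  have h2 : ∀ x : E d, ∀ ρ : ℝ, 0 < ρ →
      μ (ball x ρ) = ENNReal.ofReal (ρ ^ d) * μ (ball 0 1) := by
    intro x ρ hρ
    rw [Measure.addHaar_ball_of_pos μ x hρ]
    simp [finrank_euclideanSpace]
  have h3 : ∑ x ∈ T, μ (ball x (s / 2)) = (T.card : ℝ≥0∞) * (ENNReal.ofReal ((s / 2) ^ d) *
      μ (ball 0 1)) := by
    rw [Finset.sum_congr rfl fun x _ => h2 x (s / 2) (by positivity), Finset.sum_const,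
      nsmul_eq_mul]
  have h4 := measure_mono (μ := μ) hsub
  rw [h1, h3, h2 0 (1 + s / 2) (by positivity), ← mul_assoc] at h4
  have hpos : μ (ball (0 : E d) 1) ≠ 0 := (measure_ball_pos μ 0 one_pos).ne'
  have hfin : μ (ball (0 : E d) 1) ≠ ∞ := measure_ball_lt_top.ne
  rw [ENNReal.mul_le_mul_iff_left hpos hfin] at h4
  have h5 : (T.card : ℝ) * (s / 2) ^ d ≤ (1 + s / 2) ^ d := by
    have := ENNReal.toReal_mono ENNReal.ofReal_ne_top h4
    rwa [ENNReal.toReal_mul, ENNReal.toReal_ofReal (by positivity),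
      ENNReal.toReal_ofReal (by positivity), ENNReal.toReal_natCast] at this
  have h6 : (1 + s / 2) ^ d ≤ (3 / s) ^ d * (s / 2) ^ d := by
    rw [← mul_pow]
    apply pow_le_pow_left₀ (by positivity)
    rw [show 3 / s * (s / 2) = 3 / 2 by field_simp]
    linarith
  exact le_of_mul_le_mul_right (h5.trans h6) (by positivity)

/-- The unit sphere of `ℝ^d` has an `s`-net of at most `(3 / s) ^ d` points. -/
theorem exists_sphere_net (d : ℕ) {s : ℝ} (hs : 0 < s) (hs1 : s ≤ 1) :
    ∃ T : Finset (E d), (∀ x ∈ T, x ∈ Theta d) ∧ (T.card : ℝ) ≤ (3 / s) ^ d ∧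
      ∀ x ∈ Theta d, ∃ y ∈ T, ‖x - y‖ ≤ s := by
  classical
  let Sep : Finset (E d) → Prop := fun T => (∀ x ∈ T, ‖x‖ = 1) ∧
    ∀ x ∈ T, ∀ y ∈ T, x ≠ y → s < ‖x - y‖
  let A : Set ℕ := {k | ∃ T, Sep T ∧ T.card = k}
  have hne : A.Nonempty := ⟨0, ∅, by simp [Sep], by simp⟩
  have hbdd : BddAbove A := by
    refine ⟨⌈(3 / s) ^ d⌉₊, ?_⟩
    rintro k ⟨T, hT, rfl⟩
    exact_mod_cast (card_le_of_separated hs hs1 T hT.1 hT.2).trans (Nat.le_ceil _)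
  -- A separated set of maximal cardinality is a net, since an uncovered point could be added to it.
  obtain ⟨T, hT, hcard⟩ := Nat.sSup_mem hne hbdd
  refine ⟨T, fun x hx => by simpa using hT.1 x hx,
    card_le_of_separated hs hs1 T hT.1 hT.2, fun x hx => ?_⟩
  by_contra! hcon
  have hx1 : ‖x‖ = 1 := by simpa using hx
  have hxT : x ∉ T := fun h => by
    have := hcon x h
    simp at this; linarith
  have hmem : (insert x T).card ∈ A := by
    refine ⟨insert x T, ⟨?_, ?_⟩, rfl⟩
    · intro y hy
      rcases Finset.mem_insert.1 hy with rfl | hy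
      · exact hx1
      · exact hT.1 y hy
    · intro y hy z hz hyz
      rcases Finset.mem_insert.1 hy with hy | hy <;> rcases Finset.mem_insert.1 hz with hz | hz
      · exact absurd (hy.trans hz.symm) hyz
      · rw [hy]; exact hcon z hz
      · rw [hz, norm_sub_rev]; exact hcon y hy
      · exact hT.2 y hy z hz hyz
  have := le_csSup hbdd hmem
  rw [Finset.card_insert_of_notMem hxT, ← hcard] at this
  omega

end Net

/-! ### One-dimensional marginals of the labeled and unlabeled laws. -/

instance isProbabilityMeasure_isoGaussian {d : ℕ} (μ : E d) (σ : ℝ) :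
    IsProbabilityMeasure (isoGaussian μ σ) :=
  Measure.isProbabilityMeasure_map (by fun_prop)

instance isProbabilityMeasure_labeledLaw {d : ℕ} (μ : E d) (σ : ℝ) :
    IsProbabilityMeasure (labeledLaw μ σ) := by
  constructor
  simp [labeledLaw, ENNReal.inv_two_add_inv_two]

instance isProbabilityMeasure_unlabeledLaw {d : ℕ} (μ : E d) (σ : ℝ) :
    IsProbabilityMeasure (unlabeledLaw μ σ) := by
  constructor
  simp [unlabeledLaw, ENNReal.inv_two_add_inv_two]

theorem map_inner_stdGaussian {d : ℕ} (θ : E d) :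
    (stdGaussian (E d)).map (fun z => inner ℝ θ z)
      = (gaussianReal 0 1).map (fun z => ‖θ‖ * z) := by
  have h := IsGaussian.map_eq_gaussianReal (μ := stdGaussian (E d)) (innerSL ℝ θ)
  rw [integral_strongDual_stdGaussian, variance_dual_stdGaussian] at h
  rw [gaussianReal_map_const_mul]
  convert h using 2
  · simp
  · simp
  · rw [mul_one, innerSL_apply_norm]
    ext; simp

theorem map_inner_isoGaussian {d : ℕ} (μ : E d) (σ : ℝ) (θ : E d) :
    (isoGaussian μ σ).map (fun x => inner ℝ θ x)
      = (gaussianReal 0 1).map (fun z => inner ℝ θ μ + σ * ‖θ‖ * z) := by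
  have h1 : (fun z => inner ℝ θ μ + σ * ‖θ‖ * z)
      = (fun z : ℝ => inner ℝ θ μ + σ * z) ∘ (fun z => ‖θ‖ * z) := by
    ext z; simp [mul_assoc]
  rw [h1, ← Measure.map_map (by fun_prop) (by fun_prop), ← map_inner_stdGaussian,
    isoGaussian, Measure.map_map (by fun_prop) (by fun_prop),
    Measure.map_map (by fun_prop) (by fun_prop)]
  congr 1
  ext z
  simp [inner_add_right, inner_smul_right]

theorem map_neg_gaussianReal_affine (a b : ℝ) :
    ((gaussianReal 0 1).map (fun z => a + b * z)).map (fun u => -u)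
      = (gaussianReal 0 1).map (fun z => -a + b * z) := by
  have h : (gaussianReal 0 1).map (fun z : ℝ => -z) = gaussianReal 0 1 := by
    rw [gaussianReal_map_neg, neg_zero]
  conv_rhs => rw [← h]
  rw [Measure.map_map (by fun_prop) (by fun_prop), Measure.map_map (by fun_prop) (by fun_prop)]
  congr 1
  ext z
  simp only [Function.comp]; ring

theorem inv_two_smul_add_self {Ω : Type*} [MeasurableSpace Ω] (ν : Measure Ω) :
    (2⁻¹ : ℝ≥0∞) • ν + (2⁻¹ : ℝ≥0∞) • ν = ν := by
  rw [← add_smul, ENNReal.inv_two_add_inv_two, one_smul]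

/-- The margin `y ⟨θ, x⟩` of a labeled point is normally distributed. -/
theorem map_margin_labeledLaw {d : ℕ} (μ : E d) (σ : ℝ) (θ : E d) :
    (labeledLaw μ σ).map (fun q => q.2 * inner ℝ θ q.1)
      = (gaussianReal 0 1).map (fun z => inner ℝ θ μ + σ * ‖θ‖ * z) := by
  have hm : Measurable (fun q : E d × ℝ => q.2 * inner ℝ θ q.1) := by fun_prop
  rw [labeledLaw, Measure.map_add _ _ hm, Measure.map_smul, Measure.map_smul,
    Measure.prod_dirac, Measure.prod_dirac, Measure.map_map hm (by fun_prop),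
    Measure.map_map hm (by fun_prop)]
  have h1 : ((fun q : E d × ℝ => q.2 * inner ℝ θ q.1) ∘ fun x => (x, 1))
      = fun x => inner ℝ θ x := by ext x; simp
  have h2 : ((fun q : E d × ℝ => q.2 * inner ℝ θ q.1) ∘ fun x => (x, -1))
      = (fun u => -u) ∘ fun x => inner ℝ θ x := by ext x; simp
  rw [h1, h2, ← Measure.map_map (by fun_prop) (by fun_prop), map_inner_isoGaussian,
    map_inner_isoGaussian, map_neg_gaussianReal_affine, inner_neg_right, neg_neg,
    inv_two_smul_add_self]

/-- The two mixture components are reflections of each other, so squaring gives them the same image.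
-/
theorem map_sq_inner_unlabeledLaw {d : ℕ} (μ : E d) (σ : ℝ) (θ : E d) :
    (unlabeledLaw μ σ).map (fun x => (inner ℝ θ x) ^ 2)
      = (gaussianReal 0 1).map (fun z => (inner ℝ θ μ + σ * ‖θ‖ * z) ^ 2) := by
  have hm : Measurable (fun x : E d => (inner ℝ θ x : ℝ) ^ 2) := by fun_prop
  have h1 : (fun x : E d => (inner ℝ θ x : ℝ) ^ 2) = (fun u => u ^ 2) ∘ fun x => inner ℝ θ x := rfl
  have h2 : (fun z => (inner ℝ θ μ + σ * ‖θ‖ * z) ^ 2)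
      = (fun u => u ^ 2) ∘ fun z => inner ℝ θ μ + σ * ‖θ‖ * z := rfl
  have h3 : (fun u : ℝ => u ^ 2) = (fun u => u ^ 2) ∘ fun u => -u := by ext u; simp
  rw [unlabeledLaw, Measure.map_add _ _ hm, Measure.map_smul, Measure.map_smul, h1, h2,
    ← Measure.map_map (by fun_prop) (by fun_prop), ← Measure.map_map (by fun_prop) (by fun_prop),
    ← Measure.map_map (by fun_prop) (by fun_prop), map_inner_isoGaussian, map_inner_isoGaussian,
    inner_neg_right]
  conv_lhs =>
    arg 2
    rw [h3, ← Measure.map_map (by fun_prop) (by fun_prop), map_neg_gaussianReal_affine, neg_neg]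
  rw [inv_two_smul_add_self]

theorem map_sq_inner_labeledLaw {d : ℕ} (μ : E d) (σ : ℝ) (θ : E d) :
    (labeledLaw μ σ).map (fun q => (inner ℝ θ (q.2 • q.1)) ^ 2)
      = (gaussianReal 0 1).map (fun z => (inner ℝ θ μ + σ * ‖θ‖ * z) ^ 2) := by
  have h1 : (fun q : E d × ℝ => (inner ℝ θ (q.2 • q.1) : ℝ) ^ 2)
      = (fun u => u ^ 2) ∘ fun q => q.2 * inner ℝ θ q.1 := by
    ext q; simp [inner_smul_right]
  have h2 : (fun z => (inner ℝ θ μ + σ * ‖θ‖ * z) ^ 2)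
      = (fun u => u ^ 2) ∘ fun z => inner ℝ θ μ + σ * ‖θ‖ * z := rfl
  rw [h1, h2, ← Measure.map_map (by fun_prop) (by fun_prop),
    ← Measure.map_map (by fun_prop) (by fun_prop), map_margin_labeledLaw]

/-- Labels are typed as reals, and the closed form of the labeled robust loss is only used for
labels ±1. -/
theorem ae_labeledLaw_label {d : ℕ} (μ : E d) (σ : ℝ) :
    ∀ᵐ q ∂labeledLaw μ σ, q.2 = 1 ∨ q.2 = -1 := by
  have hms : MeasurableSet {q : E d × ℝ | q.2 = 1 ∨ q.2 = -1} := by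
    apply MeasurableSet.union
    · exact measurableSet_eq_fun (by fun_prop) (by fun_prop)
    · exact measurableSet_eq_fun (by fun_prop) (by fun_prop)
  rw [labeledLaw, ae_add_measure_iff]
  constructor
  · apply Measure.ae_smul_measure
    rw [Measure.prod_dirac, ae_map_iff (by fun_prop) hms]
    simp
  · apply Measure.ae_smul_measure
    rw [Measure.prod_dirac, ae_map_iff (by fun_prop) hms]
    simp

theorem integrable_sq_gaussianReal : Integrable (fun z : ℝ => z ^ 2) (gaussianReal 0 1) :=
  (memLp_id_gaussianReal (μ := 0) (v := 1) 2).integrable_sq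

theorem integrable_id_gaussianReal' : Integrable (fun z : ℝ => z) (gaussianReal 0 1) :=
  memLp_one_iff_integrable.1 (memLp_id_gaussianReal (μ := 0) (v := 1) 1)

theorem integrable_sq_affine_gaussianReal (a b : ℝ) :
    Integrable (fun z => (a + b * z) ^ 2) (gaussianReal 0 1) := by
  have h : (fun z => (a + b * z) ^ 2) = fun z => a ^ 2 + 2 * a * b * z + b ^ 2 * z ^ 2 := by
    ext z; ring
  rw [h]
  exact ((integrable_const _).add (integrable_id_gaussianReal'.const_mul _)).add
    (integrable_sq_gaussianReal.const_mul _)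

theorem integral_sq_affine_gaussianReal (a b : ℝ) :
    ∫ z, (a + b * z) ^ 2 ∂gaussianReal 0 1 = a ^ 2 + b ^ 2 := by
  have h : (fun z => (a + b * z) ^ 2) = fun z => a ^ 2 + 2 * a * b * z + b ^ 2 * z ^ 2 := by
    ext z; ring
  have h1 : ∫ z : ℝ, z ∂gaussianReal 0 1 = 0 := integral_id_gaussianReal
  have h2 : ∫ z : ℝ, z ^ 2 ∂gaussianReal 0 1 = 1 := by
    have := variance_fun_id_gaussianReal (μ := 0) (v := 1)
    rwa [variance_of_integral_eq_zero (by fun_prop) h1, NNReal.coe_one] at this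
  have hl : Integrable (fun z : ℝ => a ^ 2 + 2 * a * b * z) (gaussianReal 0 1) :=
    (integrable_const _).add (integrable_id_gaussianReal'.const_mul _)
  rw [h, integral_add hl (integrable_sq_gaussianReal.const_mul _),
    integral_add (integrable_const _) (integrable_id_gaussianReal'.const_mul _),
    integral_const_mul, integral_const_mul, h1, h2]
  simp

/-! ### Uniform concentration of empirical second moments. -/

/-- The supremum over the sphere of a quadratic form is at most twice its supremum over a
`1/4`-net. -/
theorem abs_quadratic_le_of_net {d : ℕ} (B : E d →ₗ[ℝ] E d →ₗ[ℝ] ℝ)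
    (hB : ∀ u v, B u v = B v u) (hc : Continuous fun u => B u u) {T : Set (E d)}
    (hT : T ⊆ Theta d) (hnet : ∀ x ∈ Theta d, ∃ y ∈ T, ‖x - y‖ ≤ 1 / 4) {e : ℝ}
    (he : ∀ y ∈ T, |B y y| ≤ e) : ∀ x ∈ Theta d, |B x x| ≤ 2 * e := by
  intro x₀ hx₀
  obtain ⟨x, hx, hmax⟩ := (isCompact_sphere (0 : E d) 1).exists_isMaxOn ⟨x₀, hx₀⟩
    (continuous_abs.comp hc).continuousOn
  set S := |B x x| with hS
  have hS0 : 0 ≤ S := abs_nonneg _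
  have hmax' : ∀ u ∈ Theta d, |B u u| ≤ S := fun u hu => hmax hu
  have hquad : ∀ u, |B u u| ≤ S * ‖u‖ ^ 2 := by
    intro u
    by_cases hu : u = 0
    · simp [hu]
    · have hn : ‖u‖ ≠ 0 := norm_ne_zero_iff.2 hu
      have h1 := hmax' (‖u‖⁻¹ • u) (by simp [norm_smul, hn])
      have h2 : B (‖u‖⁻¹ • u) (‖u‖⁻¹ • u) = (‖u‖⁻¹) ^ 2 * B u u := by
        simp only [map_smul, LinearMap.smul_apply, smul_eq_mul]; ring
      rw [h2, abs_mul, abs_of_nonneg (by positivity : (0 : ℝ) ≤ (‖u‖⁻¹) ^ 2)] at h1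
      have h3 : (‖u‖⁻¹) ^ 2 * ‖u‖ ^ 2 = 1 := by field_simp
      calc |B u u| = ((‖u‖⁻¹) ^ 2 * |B u u|) * ‖u‖ ^ 2 := by linear_combination (-|B u u|) * h3
        _ ≤ S * ‖u‖ ^ 2 := by gcongr
  -- Polarization and the parallelogram law: a symmetric form is bounded on the unit ball by its
  -- quadratic maximum.
  have hbil : ∀ u v : E d, ‖u‖ ≤ 1 → ‖v‖ ≤ 1 → |B u v| ≤ S := by
    intro u v hu hv
    have h1 : B u v = (B (u + v) (u + v) - B (u - v) (u - v)) / 4 := by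
      simp only [map_add, map_sub, LinearMap.add_apply, LinearMap.sub_apply]
      rw [hB v u]; ring
    have h2 := parallelogram_law_with_norm ℝ u v
    have h3 := abs_sub (B (u + v) (u + v)) (B (u - v) (u - v))
    have h4 := hquad (u + v)
    have h5 := hquad (u - v)
    have hu2 : ‖u‖ * ‖u‖ ≤ 1 := by nlinarith [norm_nonneg u]
    have hv2 : ‖v‖ * ‖v‖ ≤ 1 := by nlinarith [norm_nonneg v]
    rw [h1, abs_div, abs_of_pos (by norm_num : (0 : ℝ) < 4), div_le_iff₀ (by norm_num)]
    nlinarith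
  obtain ⟨y, hy, hxy⟩ := hnet x hx
  have hx1 : ‖x‖ = 1 := by simpa using hx
  have hy1 : ‖y‖ = 1 := by simpa using hT hy
  -- Both rescaled arguments have norm at most 1, so S ≤ e + S/2, and S/2 is absorbed because the
  -- maximum S is attained at x.
  have h1 : B x x - B y y = (1 / 2) * B ((4 : ℝ) • (x - y)) ((1 / 2 : ℝ) • (x + y)) := by
    simp only [map_add, map_sub, map_smul, LinearMap.sub_apply, LinearMap.smul_apply, smul_eq_mul]
    rw [hB y x]; ring
  have h2 := hbil ((4 : ℝ) • (x - y)) ((1 / 2 : ℝ) • (x + y))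
    (by rw [norm_smul, Real.norm_of_nonneg (by norm_num)]; linarith)
    (by rw [norm_smul, Real.norm_of_nonneg (by norm_num)]; linarith [norm_add_le x y])
  have h3 : |B x x| ≤ |B y y| + |B x x - B y y| := by
    have := abs_add_le (B y y) (B x x - B y y)
    rwa [add_sub_cancel] at this
  rw [h1, abs_mul, abs_of_pos (by norm_num : (0 : ℝ) < 1 / 2)] at h3
  have h4 := he y hy
  have h5 := hmax' x₀ hx₀
  linarith

/-- Bernstein's condition for the square of a normal variable. -/
theorem exists_bernstein_sq_gaussianReal {M : ℝ} (hM : 1 ≤ M) :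
    ∃ s₀ V : ℝ, 0 < s₀ ∧ 0 < V ∧ ∀ a b : ℝ, |a| ≤ M → |b| ≤ M →
      Integrable (fun z => ((a + b * z) ^ 2 - (a ^ 2 + b ^ 2)) ^ 2 *
        Real.exp (s₀ * |(a + b * z) ^ 2 - (a ^ 2 + b ^ 2)|)) (gaussianReal 0 1) ∧
      ∫ z, ((a + b * z) ^ 2 - (a ^ 2 + b ^ 2)) ^ 2 *
        Real.exp (s₀ * |(a + b * z) ^ 2 - (a ^ 2 + b ^ 2)|) ∂gaussianReal 0 1 ≤ V := by
  obtain ⟨c, hc, hci⟩ := IsGaussian.exists_integrable_exp_sq (gaussianReal 0 1)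
  -- With c from Fernique's theorem, the exponent 2s₀(4M² + 2M²z²) equals 2c + cz². One factor
  -- exp(s₀|y|) is spent on bounding y².
  set s₀ := c / (4 * M ^ 2) with hs₀
  have hs0 : 0 < s₀ := by positivity
  set I := ∫ z : ℝ, Real.exp (c * ‖z‖ ^ 2) ∂gaussianReal 0 1 with hI
  have hI0 : 0 ≤ I := integral_nonneg fun z => (Real.exp_pos _).le
  have hb : ∀ a b : ℝ, |a| ≤ M → |b| ≤ M → ∀ z : ℝ,
      ((a + b * z) ^ 2 - (a ^ 2 + b ^ 2)) ^ 2 *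
        Real.exp (s₀ * |(a + b * z) ^ 2 - (a ^ 2 + b ^ 2)|)
      ≤ (2 / s₀ ^ 2 * Real.exp (2 * c)) * Real.exp (c * ‖z‖ ^ 2) := by
    intro a b ha hb z
    set y := (a + b * z) ^ 2 - (a ^ 2 + b ^ 2) with hy
    have ha2 : a ^ 2 ≤ M ^ 2 := sq_le_sq' (by linarith [neg_abs_le a]) (le_of_abs_le ha)
    have hb2 : b ^ 2 ≤ M ^ 2 := sq_le_sq' (by linarith [neg_abs_le b]) (le_of_abs_le hb)
    have h1 : |y| ≤ 4 * M ^ 2 + 2 * M ^ 2 * z ^ 2 := by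
      have hbz : b ^ 2 * z ^ 2 ≤ M ^ 2 * z ^ 2 := by gcongr
      rw [abs_le]
      constructor
      · nlinarith [sq_nonneg (a + b * z), sq_nonneg z, mul_nonneg (sq_nonneg M) (sq_nonneg z)]
      · nlinarith [sq_nonneg (a - b * z)]
    have h2 : (s₀ * |y|) ^ 2 / 2 ≤ Real.exp (s₀ * |y|) := by
      have := Real.quadratic_le_exp_of_nonneg (x := s₀ * |y|) (by positivity)
      linarith [show 0 ≤ s₀ * |y| by positivity]
    have h3 : y ^ 2 ≤ 2 / s₀ ^ 2 * Real.exp (s₀ * |y|) := by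
      rw [mul_pow, sq_abs] at h2
      rw [div_mul_eq_mul_div, le_div_iff₀ (by positivity)]
      linarith
    calc y ^ 2 * Real.exp (s₀ * |y|)
        ≤ (2 / s₀ ^ 2 * Real.exp (s₀ * |y|)) * Real.exp (s₀ * |y|) := by gcongr
      _ = 2 / s₀ ^ 2 * Real.exp (2 * s₀ * |y|) := by
          rw [mul_assoc, ← Real.exp_add]; ring_nf
      _ ≤ 2 / s₀ ^ 2 * Real.exp (2 * s₀ * (4 * M ^ 2 + 2 * M ^ 2 * z ^ 2)) := by gcongr
      _ = (2 / s₀ ^ 2 * Real.exp (2 * c)) * Real.exp (c * ‖z‖ ^ 2) := by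
          rw [mul_assoc (2 / s₀ ^ 2), ← Real.exp_add, Real.norm_eq_abs, sq_abs]
          congr 2
          rw [hs₀]; field_simp; ring
  refine ⟨s₀, (2 / s₀ ^ 2 * Real.exp (2 * c)) * I + 1, hs0, by positivity, fun a b ha hbM => ?_⟩
  have hgi := hci.const_mul (2 / s₀ ^ 2 * Real.exp (2 * c))
  have hfi : Integrable (fun z => ((a + b * z) ^ 2 - (a ^ 2 + b ^ 2)) ^ 2 *
        Real.exp (s₀ * |(a + b * z) ^ 2 - (a ^ 2 + b ^ 2)|)) (gaussianReal 0 1) := by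
    refine hgi.mono' (Continuous.aestronglyMeasurable (by fun_prop)) (ae_of_all _ fun z => ?_)
    rw [Real.norm_eq_abs, abs_of_nonneg (by positivity)]
    exact hb a b ha hbM z
  refine ⟨hfi, (integral_mono hfi hgi (hb a b ha hbM)).trans ?_⟩
  rw [integral_const_mul]
  linarith

/-- The deviation of the empirical second moment form from `⟨u, μ⟩ ⟨v, μ⟩ + σ² ⟨u, v⟩`. -/
noncomputable def momentDeviation {d N : ℕ} (w : Fin N → E d) (μ : E d) (σ : ℝ) :
    E d →ₗ[ℝ] E d →ₗ[ℝ] ℝ :=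
  LinearMap.mk₂ ℝ (fun u v => (1 / N : ℝ) * ∑ i, inner ℝ u (w i) * inner ℝ v (w i)
      - (inner ℝ u μ * inner ℝ v μ + σ ^ 2 * inner ℝ u v))
    (fun u u' v => by
      simp only [inner_add_left, add_mul, Finset.sum_add_distrib]; ring)
    (fun c u v => by
      simp only [real_inner_smul_left, smul_eq_mul, mul_assoc, ← Finset.mul_sum]; ring)
    (fun u v v' => by
      simp only [inner_add_left, inner_add_right, mul_add, Finset.sum_add_distrib]; ring)
    (fun c u v => by
      simp only [real_inner_smul_left, real_inner_smul_right, smul_eq_mul, mul_left_comm _ c,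
        ← Finset.mul_sum]; ring)

theorem momentDeviation_apply {d N : ℕ} (w : Fin N → E d) (μ : E d) (σ : ℝ) (u v : E d) :
    momentDeviation w μ σ u v = (1 / N : ℝ) * ∑ i, inner ℝ u (w i) * inner ℝ v (w i)
      - (inner ℝ u μ * inner ℝ v μ + σ ^ 2 * inner ℝ u v) := rfl

theorem momentDeviation_self {d N : ℕ} (w : Fin N → E d) (μ : E d) (σ : ℝ) {u : E d}
    (hu : u ∈ Theta d) :
    momentDeviation w μ σ u u = (1 / N : ℝ) * ∑ i, inner ℝ u (w i) ^ 2
      - (inner ℝ u μ ^ 2 + σ ^ 2) := by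
  have hu1 : ‖u‖ = 1 := by simpa using hu
  rw [momentDeviation_apply, real_inner_self_eq_norm_sq, hu1]
  simp only [← sq]; ring

theorem abs_inner_le_of_mem_Theta {d : ℕ} {θ μ : E d} {M : ℝ} (hθ : θ ∈ Theta d) (hμ : ‖μ‖ ≤ M) :
    |inner ℝ θ μ| ≤ M := by
  have hu1 : ‖θ‖ = 1 := by simpa using hθ
  have := abs_real_inner_le_norm θ μ
  rw [hu1, one_mul] at this
  exact this.trans hμ

/-- Concentration of the empirical second moment in a fixed direction. -/
theorem exists_direction_deviation {M : ℝ} (hM : 1 ≤ M) :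
    ∃ C : ℝ, 0 < C ∧ ∀ {Ω : Type} [MeasurableSpace Ω] (P : Measure Ω) [IsProbabilityMeasure P]
      (X : Ω → ℝ) (a b : ℝ), Measurable X → |a| ≤ M → |b| ≤ M →
      P.map (fun ω => X ω ^ 2) = (gaussianReal 0 1).map (fun z => (a + b * z) ^ 2) →
      ∀ (N : ℕ) (x : ℝ), 1 ≤ N → 0 ≤ x →
        (Measure.pi fun _ : Fin N => P)
          {ω | C * (x + x ^ 2) < |(1 / N : ℝ) * ∑ i, X (ω i) ^ 2 - (a ^ 2 + b ^ 2)|}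
          ≤ ENNReal.ofReal (2 * Real.exp (-(4 * (N * x ^ 2)))) := by
  obtain ⟨s₀, V, hs0, hV, hbern⟩ := exists_bernstein_sq_gaussianReal hM
  -- The summand 4 yields a tail exp(-4Nx²), strong enough to pay for the union bound over a
  -- 1/4-net.
  refine ⟨(s₀ ^ 2 * V + 4) / s₀, by positivity, ?_⟩
  intro Ω _ P _ X a b hX ha hb hlaw N x hN hx
  set C := (s₀ ^ 2 * V + 4) / s₀ with hC
  have hCs : s₀ * C = s₀ ^ 2 * V + 4 := by rw [hC]; field_simp
  have hN0 : (0 : ℝ) < N := by exact_mod_cast hN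
  obtain ⟨hi, hle⟩ := hbern a b ha hb
  -- transfer of integrals to the standard normal law
  have hXm : Measurable fun ω => X ω ^ 2 := by fun_prop
  have hzm : Measurable fun z : ℝ => (a + b * z) ^ 2 := by fun_prop
  have hint : ∀ F : ℝ → ℝ, Measurable F →
      ∫ ω, F (X ω ^ 2) ∂P = ∫ z, F ((a + b * z) ^ 2) ∂gaussianReal 0 1 := by
    intro F hF
    rw [← integral_map hXm.aemeasurable hF.aestronglyMeasurable, hlaw,
      integral_map hzm.aemeasurable hF.aestronglyMeasurable]
  have hintb : ∀ F : ℝ → ℝ, Measurable F →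
      Integrable (fun z => F ((a + b * z) ^ 2)) (gaussianReal 0 1) →
      Integrable (fun ω => F (X ω ^ 2)) P := by
    intro F hF h
    have h1 : Integrable F ((gaussianReal 0 1).map fun z => (a + b * z) ^ 2) :=
      (integrable_map_measure hF.aestronglyMeasurable hzm.aemeasurable).2 h
    rw [← hlaw] at h1
    exact (integrable_map_measure hF.aestronglyMeasurable hXm.aemeasurable).1 h1
  have hXi : Integrable (fun ω => X ω ^ 2) P :=
    hintb (fun u => u) measurable_id (integrable_sq_affine_gaussianReal a b)
  have hXmean : ∫ ω, X ω ^ 2 ∂P = a ^ 2 + b ^ 2 :=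
    (hint (fun u => u) measurable_id).trans (integral_sq_affine_gaussianReal a b)
  set F : ℝ → ℝ := fun u => (u - (a ^ 2 + b ^ 2)) ^ 2 * Real.exp (s₀ * |u - (a ^ 2 + b ^ 2)|)
  have hF : Measurable F := by fun_prop
  have hVi : Integrable (fun ω => F (X ω ^ 2)) P := hintb F hF hi
  have hVle : ∫ ω, F (X ω ^ 2) ∂P ≤ V := (hint F hF).trans_le hle
  -- the exponent
  have hexp : ∃ s, 0 ≤ s ∧ s ≤ s₀ ∧
      N * (s ^ 2 * V) - s * (N * (C * (x + x ^ 2))) ≤ -(4 * (N * x ^ 2)) := by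
    -- The sub-Gaussian range x ≤ 1 uses s = s₀x; the subexponential range uses the cap s = s₀.
    rcases le_total x 1 with h | h
    · refine ⟨s₀ * x, by positivity, by nlinarith, ?_⟩
      have h1 : N * ((s₀ * x) ^ 2 * V) - s₀ * x * (N * (C * (x + x ^ 2)))
          = N * x ^ 2 * (s₀ ^ 2 * V - s₀ * C * (1 + x)) := by ring
      rw [h1, hCs]
      have h2 : s₀ ^ 2 * V - (s₀ ^ 2 * V + 4) * (1 + x) ≤ -4 := by
        nlinarith [show 0 ≤ s₀ ^ 2 * V by positivity]
      nlinarith [mul_le_mul_of_nonneg_left h2 (show 0 ≤ N * x ^ 2 by positivity)]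
    · refine ⟨s₀, hs0.le, le_rfl, ?_⟩
      have h1 : N * (s₀ ^ 2 * V) - s₀ * (N * (C * (x + x ^ 2)))
          = N * (s₀ ^ 2 * V - s₀ * C * (x + x ^ 2)) := by ring
      rw [h1, hCs]
      have h2 : s₀ ^ 2 * V - (s₀ ^ 2 * V + 4) * (x + x ^ 2) ≤ -(4 * x ^ 2) := by
        nlinarith [show 0 ≤ s₀ ^ 2 * V by positivity, mul_nonneg
          (show 0 ≤ s₀ ^ 2 * V by positivity) (show 0 ≤ x + x ^ 2 - 1 by nlinarith)]
      nlinarith [mul_le_mul_of_nonneg_left h2 hN0.le]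
  obtain ⟨s, hs, hss, hexp⟩ := hexp
  have hup := pi_measure_sum_ge_le_of_bernstein (P := P) (s := s) (s₀ := s₀) (V := V)
    (Y := fun ω => X ω ^ 2 - (a ^ 2 + b ^ 2)) (by fun_prop) (hXi.sub (integrable_const _))
    (by rw [integral_sub hXi (integrable_const _), hXmean]; simp) hVi hVle hs hss N
    (N * (C * (x + x ^ 2)))
  have hlo := pi_measure_sum_ge_le_of_bernstein (P := P) (s := s) (s₀ := s₀) (V := V)
    (Y := fun ω => -(X ω ^ 2 - (a ^ 2 + b ^ 2))) (by fun_prop) (hXi.sub (integrable_const _)).neg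
    (by rw [integral_neg, integral_sub hXi (integrable_const _), hXmean]; simp)
    (by simpa only [neg_sq, abs_neg] using hVi) (by simpa only [neg_sq, abs_neg] using hVle)
    hs hss N (N * (C * (x + x ^ 2)))
  have hsum : ∀ ω : Fin N → Ω, ∑ i, (X (ω i) ^ 2 - (a ^ 2 + b ^ 2))
      = N * ((1 / N : ℝ) * ∑ i, X (ω i) ^ 2 - (a ^ 2 + b ^ 2)) := by
    intro ω
    rw [Finset.sum_sub_distrib, Finset.sum_const, Finset.card_univ, Fintype.card_fin,
      nsmul_eq_mul]
    field_simp
  have hsub : {ω : Fin N → Ω |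
        C * (x + x ^ 2) < |(1 / N : ℝ) * ∑ i, X (ω i) ^ 2 - (a ^ 2 + b ^ 2)|}
      ⊆ {ω | N * (C * (x + x ^ 2)) ≤ ∑ i, (X (ω i) ^ 2 - (a ^ 2 + b ^ 2))}
        ∪ {ω | N * (C * (x + x ^ 2)) ≤ ∑ i, -(X (ω i) ^ 2 - (a ^ 2 + b ^ 2))} := by
    intro ω hω
    simp only [Set.mem_union, Set.mem_ofPred_eq] at hω ⊢
    rw [Finset.sum_neg_distrib, hsum]
    rcases lt_abs.1 hω with h | h
    · left; gcongr
    · right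
      rw [← mul_neg]; gcongr
  refine (measure_mono hsub).trans ((measure_union_le _ _).trans ((add_le_add hup hlo).trans ?_))
  rw [← ENNReal.ofReal_add (by positivity) (by positivity), ← two_mul]
  gcongr

/-- Concentration of the empirical second moments, uniformly over all directions. -/
theorem exists_uniform_moment_deviation {M : ℝ} (hM : 1 ≤ M) :
    ∃ C : ℝ, 0 < C ∧ ∀ {Ω : Type} [MeasurableSpace Ω] (P : Measure Ω) [IsProbabilityMeasure P]
      (d N : ℕ) (w : Ω → E d) (μ : E d) (σ t x : ℝ), Measurable w → ‖μ‖ ≤ M → |σ| ≤ M →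
      (∀ θ ∈ Theta d, P.map (fun ω => inner ℝ θ (w ω) ^ 2)
        = (gaussianReal 0 1).map (fun z => (inner ℝ θ μ + σ * z) ^ 2)) →
      1 ≤ d → 1 ≤ N → 0 ≤ t → 0 ≤ x → N * x ^ 2 = d + t →
        (Measure.pi fun _ : Fin N => P)
          {ω | ¬ ∀ θ ∈ Theta d, |(1 / N : ℝ) * ∑ i, inner ℝ θ (w (ω i)) ^ 2
            - (inner ℝ θ μ ^ 2 + σ ^ 2)| ≤ C * (x + x ^ 2)}
          ≤ ENNReal.ofReal (Real.exp (-t)) := by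
  obtain ⟨C, hC, hdir⟩ := exists_direction_deviation hM
  refine ⟨2 * C, by positivity, ?_⟩
  intro Ω _ P _ d N w μ σ t x hw hμ hσ hlaw hd hN ht hx hx2
  obtain ⟨T, hT, hcard, hnet⟩ := exists_sphere_net d (s := 1 / 4) (by norm_num) (by norm_num)
  have hsub : {ω : Fin N → Ω | ¬ ∀ θ ∈ Theta d, |(1 / N : ℝ) * ∑ i, inner ℝ θ (w (ω i)) ^ 2
            - (inner ℝ θ μ ^ 2 + σ ^ 2)| ≤ 2 * C * (x + x ^ 2)}
      ⊆ ⋃ θ ∈ T, {ω | C * (x + x ^ 2) < |(1 / N : ℝ) * ∑ i, inner ℝ θ (w (ω i)) ^ 2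
            - (inner ℝ θ μ ^ 2 + σ ^ 2)|} := by
    intro ω hω
    by_contra hcon
    simp only [Set.mem_iUnion, Set.mem_ofPred_eq, not_exists, not_lt] at hcon
    apply hω
    intro θ hθ
    have := abs_quadratic_le_of_net (momentDeviation (fun i => w (ω i)) μ σ)
      (fun u v => by
        simp only [momentDeviation_apply, mul_comm (inner ℝ u _), real_inner_comm u v])
      (by simp only [momentDeviation_apply]; fun_prop) (T := (T : Set (E d))) hT hnet
      (e := C * (x + x ^ 2))
      (fun y hy => by rw [momentDeviation_self _ _ _ (hT y hy)]; exact hcon y hy) θ hθ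
    rw [momentDeviation_self _ _ _ hθ] at this
    linarith
  refine (measure_mono hsub).trans ((measure_biUnion_finset_le _ _).trans ?_)
  have hone : ∀ θ ∈ T, (Measure.pi fun _ : Fin N => P)
      {ω | C * (x + x ^ 2) < |(1 / N : ℝ) * ∑ i, inner ℝ θ (w (ω i)) ^ 2
            - (inner ℝ θ μ ^ 2 + σ ^ 2)|}
      ≤ ENNReal.ofReal (2 * Real.exp (-(4 * (d + t)))) := by
    intro θ hθ
    rw [← hx2]
    exact hdir P (fun ω => inner ℝ θ (w ω)) (inner ℝ θ μ) σ (by fun_prop)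
      (abs_inner_le_of_mem_Theta (hT θ hθ) hμ) hσ (hlaw θ (hT θ hθ)) N x hN hx
  refine (Finset.sum_le_sum hone).trans ?_
  rw [Finset.sum_const, nsmul_eq_mul, ← ENNReal.ofReal_natCast, ← ENNReal.ofReal_mul (by positivity)]
  apply ENNReal.ofReal_le_ofReal
  -- The net has at most 12^d points and each contributes two tails. Their total cost exp(3d) ·
  -- exp(d) cancels the factor exp(-4d).
  have h12 : (12 : ℝ) ≤ Real.exp 3 := by
    have := Real.exp_one_gt_d9
    rw [show (3 : ℝ) = 1 + 1 + 1 by norm_num, Real.exp_add, Real.exp_add]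
    nlinarith [Real.exp_pos 1, mul_pos (Real.exp_pos 1) (Real.exp_pos 1)]
  have h2 : (2 : ℝ) ≤ Real.exp d := by
    have h1 : (1 : ℝ) ≤ d := by exact_mod_cast hd
    have := Real.add_one_le_exp (d : ℝ)
    linarith
  calc (T.card : ℝ) * (2 * Real.exp (-(4 * (d + t))))
      ≤ (Real.exp 3) ^ d * (Real.exp d * Real.exp (-(4 * (d + t)))) := by
        gcongr
        refine hcard.trans ?_
        apply pow_le_pow_left₀ (by norm_num)
        linarith
    _ = Real.exp (-(4 * t)) := by
        rw [← Real.exp_nat_mul, ← Real.exp_add, ← Real.exp_add]; ring_nf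
    _ ≤ Real.exp (-t) := by apply Real.exp_le_exp.2; linarith

/-! ### The ramp loss: expected gap and localized deviations. -/

/-- The ramp function, which is the robust loss as a function of the margin. -/
noncomputable def ramp (u : ℝ) : ℝ := max 0 (min 1 (1 - u))

theorem ramp_nonneg (u : ℝ) : 0 ≤ ramp u := le_max_left _ _

theorem ramp_le_one (u : ℝ) : ramp u ≤ 1 := max_le zero_le_one (min_le_left _ _)

theorem continuous_ramp : Continuous ramp := by unfold ramp; fun_prop

@[fun_prop]
theorem measurable_ramp : Measurable ramp := continuous_ramp.measurable

theorem antitone_ramp : Antitone ramp := fun u v h => by unfold ramp; gcongr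

theorem abs_ramp_sub_le (u v : ℝ) : |ramp u - ramp v| ≤ |u - v| := by
  have h1 := abs_max_sub_max_le_max 0 (min 1 (1 - u)) 0 (min 1 (1 - v))
  have h2 := abs_min_sub_min_le_max 1 (1 - u) 1 (1 - v)
  simp only [sub_self, abs_zero, abs_nonneg, sup_of_le_right] at h1 h2
  rw [show 1 - u - (1 - v) = v - u by ring, abs_sub_comm v u] at h2
  exact h1.trans h2

/-- From such a u the ramp falls with slope -1 for at least another half unit. -/
theorem min_le_ramp_sub_ramp {u v : ℝ} (h0 : 0 ≤ u) (h1 : u ≤ 1 / 2) (huv : u ≤ v) :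
    min (v - u) (1 / 2) ≤ ramp u - ramp v := by
  have h2 : ramp u = 1 - u := by
    unfold ramp; rw [min_eq_right (by linarith), max_eq_right (by linarith)]
  rw [h2]
  rcases le_total v 1 with h | h
  · have h3 : ramp v = 1 - v := by
      unfold ramp; rw [min_eq_right (by linarith), max_eq_right (by linarith)]
    rw [h3]
    exact (min_le_left _ _).trans (by linarith)
  · have h3 : ramp v = 0 := by
      unfold ramp; rw [min_eq_right (by linarith), max_eq_left (by linarith)]
    rw [h3]
    exact (min_le_right _ _).trans (by linarith)

theorem gaussianPDFReal_zero_one (z : ℝ) :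
    gaussianPDFReal 0 1 z = (√(2 * Real.pi))⁻¹ * Real.exp (-z ^ 2 / 2) := by
  simp [gaussianPDFReal_def]

theorem real_gaussianReal_eq (s : Set ℝ) :
    (gaussianReal 0 1).real s = ∫ z in s, gaussianPDFReal 0 1 z := by
  rw [measureReal_def, gaussianReal_apply_eq_integral 0 one_ne_zero, ENNReal.toReal_ofReal]
  exact integral_nonneg fun z => gaussianPDFReal_nonneg _ _ _

theorem real_gaussianReal_Ioc_le {a b : ℝ} (hab : a ≤ b) :
    (gaussianReal 0 1).real (Set.Ioc a b) ≤ b - a := by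
  have hpdf : ∀ z, gaussianPDFReal 0 1 z ≤ 1 := by
    intro z
    rw [gaussianPDFReal_zero_one]
    have h1 : (√(2 * Real.pi))⁻¹ ≤ 1 := by
      apply inv_le_one_of_one_le₀
      rw [Real.one_le_sqrt]
      linarith [Real.pi_gt_three]
    have h2 : Real.exp (-z ^ 2 / 2) ≤ 1 := by
      rw [Real.exp_le_one_iff]; nlinarith [sq_nonneg z]
    exact mul_le_one₀ h1 (Real.exp_pos _).le h2
  rw [real_gaussianReal_eq]
  have h := setIntegral_mono_on (μ := volume) (s := Set.Ioc a b)
    (integrable_gaussianPDFReal 0 1).integrableOn (g := fun _ => (1 : ℝ))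
    (integrableOn_const (by simp)) measurableSet_Ioc (fun z _ => hpdf z)
  refine h.trans ?_
  rw [setIntegral_const, measureReal_def, Real.volume_Ioc, ENNReal.toReal_ofReal (by linarith)]
  simp

theorem le_real_gaussianReal_Icc {a b R : ℝ} (hab : a ≤ b) (ha : -R ≤ a) (hb : b ≤ R) :
    gaussianPDFReal 0 1 R * (b - a) ≤ (gaussianReal 0 1).real (Set.Icc a b) := by
  rw [real_gaussianReal_eq]
  have h := setIntegral_mono_on (μ := volume) (s := Set.Icc a b)
    (f := fun _ => gaussianPDFReal 0 1 R) (integrableOn_const (by simp))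
    (integrable_gaussianPDFReal 0 1).integrableOn measurableSet_Icc (fun z hz => by
      rw [gaussianPDFReal_zero_one, gaussianPDFReal_zero_one]
      gcongr ?_ * Real.exp (-?_ / 2)
      exact sq_le_sq' (by linarith [hz.1]) (by linarith [hz.2]))
  refine le_trans ?_ h
  rw [setIntegral_const, measureReal_def, Real.volume_Icc, ENNReal.toReal_ofReal (by linarith),
    smul_eq_mul, mul_comm]

theorem integrable_ramp_comp {Ω : Type*} [MeasurableSpace Ω] (P : Measure Ω)
    [IsProbabilityMeasure P] {f : Ω → ℝ} (hf : Measurable f) :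
    Integrable (fun ω => ramp (f ω)) P := by
  refine Integrable.of_bound (measurable_ramp.comp hf).aestronglyMeasurable 1
    (ae_of_all _ fun ω => ?_)
  rw [Real.norm_eq_abs, abs_of_nonneg (ramp_nonneg _)]
  exact ramp_le_one _

/-- The expected ramp loss grows linearly as the mean of the margin decreases. -/
theorem exists_ramp_expectation_gap {r σ : ℝ} (hr : 0 < r) (hσ : 0 < σ) :
    ∃ κ : ℝ, 0 < κ ∧ ∀ a : ℝ, |a| ≤ r →
      κ * (r - a) ≤ ∫ z, (ramp (a + σ * z) - ramp (r + σ * z)) ∂gaussianReal 0 1 := by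
  set R := (r + 1) / σ with hR
  set p := gaussianPDFReal 0 1 R * (1 / (2 * σ)) with hp
  have hp0 : 0 < p := mul_pos (gaussianPDFReal_pos _ _ _ one_ne_zero) (by positivity)
  -- Since r - a ≤ 2r, the first factor converts the capped drop min(r - a, 1/2) into a linear one.
  refine ⟨min 1 (1 / (4 * r)) * p, by positivity, fun a ha => ?_⟩
  obtain ⟨ha1, ha2⟩ := abs_le.1 ha
  -- On J the margin a + σz lies in [0, 1/2]. For all |a| ≤ r this interval has length 1/(2σ) and
  -- stays within [-R, R], so its Gaussian mass is at least p.
  set J := Set.Icc (-a / σ) ((1 / 2 - a) / σ) with hJ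
  have hJp : p ≤ (gaussianReal 0 1).real J := by
    have h := le_real_gaussianReal_Icc (a := -a / σ) (b := (1 / 2 - a) / σ) (R := R)
      (by gcongr; linarith) (by rw [hR, ← neg_div]; gcongr; linarith)
      (by rw [hR]; gcongr; linarith)
    refine le_trans (le_of_eq ?_) h
    rw [hp]; congr 1; field_simp; ring
  have hmin : min 1 (1 / (4 * r)) * (r - a) ≤ min (r - a) (1 / 2) := by
    apply le_min
    · exact mul_le_of_le_one_left (by linarith) (min_le_left _ _)
    · calc min 1 (1 / (4 * r)) * (r - a) ≤ 1 / (4 * r) * (2 * r) := by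
            gcongr
            · exact min_le_right _ _
            · linarith
        _ = 1 / 2 := by field_simp; norm_num
  have hi : Integrable (fun z => ramp (a + σ * z) - ramp (r + σ * z)) (gaussianReal 0 1) :=
    (integrable_ramp_comp _ (by fun_prop)).sub (integrable_ramp_comp _ (by fun_prop))
  calc min 1 (1 / (4 * r)) * p * (r - a)
      = p * (min 1 (1 / (4 * r)) * (r - a)) := by ring
    _ ≤ (gaussianReal 0 1).real J * min (r - a) (1 / 2) := by
        gcongr
    _ = ∫ z in J, min (r - a) (1 / 2) ∂gaussianReal 0 1 := by
        rw [setIntegral_const, smul_eq_mul]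
    _ ≤ ∫ z in J, (ramp (a + σ * z) - ramp (r + σ * z)) ∂gaussianReal 0 1 := by
        refine setIntegral_mono_on (integrableOn_const (by simp)) hi.integrableOn
          measurableSet_Icc fun z hz => ?_
        have h1 : -a ≤ σ * z := by
          have := hz.1; rw [div_le_iff₀ hσ] at this; linarith
        have h2 : σ * z ≤ 1 / 2 - a := by
          have := hz.2; rw [le_div_iff₀ hσ] at this; linarith
        have h3 := min_le_ramp_sub_ramp (u := a + σ * z) (v := r + σ * z) (by linarith)
          (by linarith) (by linarith)
        rwa [show r + σ * z - (a + σ * z) = r - a by ring] at h3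
    _ ≤ ∫ z, (ramp (a + σ * z) - ramp (r + σ * z)) ∂gaussianReal 0 1 :=
        setIntegral_le_integral hi (ae_of_all _ fun z =>
          sub_nonneg.2 (antitone_ramp (by linarith)))

/-- The margin `y ⟨θ, x⟩` of a labeled point `q = (x, y)`. -/
noncomputable def margin {d : ℕ} (θ : E d) (q : E d × ℝ) : ℝ := q.2 * inner ℝ θ q.1

@[fun_prop]
theorem measurable_margin {d : ℕ} (θ : E d) : Measurable (margin θ) := by
  unfold margin; fun_prop

theorem margin_eq_inner {d : ℕ} (θ : E d) (q : E d × ℝ) :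
    margin θ q = inner ℝ θ (q.2 • q.1) := by
  rw [margin, inner_smul_right]

theorem integral_comp_margin {d : ℕ} (μ : E d) (σ : ℝ) {θ : E d} (hθ : θ ∈ Theta d)
    {F : ℝ → ℝ} (hF : Measurable F) :
    ∫ q, F (margin θ q) ∂labeledLaw μ σ
      = ∫ z, F (inner ℝ θ μ + σ * z) ∂gaussianReal 0 1 := by
  have hu1 : ‖θ‖ = 1 := by simpa using hθ
  have h := map_margin_labeledLaw μ σ θ
  rw [hu1, mul_one] at h
  rw [← integral_map (measurable_margin θ).aemeasurable hF.aestronglyMeasurable]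
  unfold margin
  rw [h, integral_map (by fun_prop) hF.aestronglyMeasurable]

theorem integral_sq_margin {d : ℕ} (μ : E d) (σ : ℝ) (θ : E d) :
    Integrable (fun q => margin θ q ^ 2) (labeledLaw μ σ) ∧
    ∫ q, margin θ q ^ 2 ∂labeledLaw μ σ = inner ℝ θ μ ^ 2 + (σ * ‖θ‖) ^ 2 := by
  have h := map_margin_labeledLaw μ σ θ
  have hz : Measurable fun z : ℝ => inner ℝ θ μ + σ * ‖θ‖ * z := by fun_prop
  have hsq : Measurable fun u : ℝ => u ^ 2 := by fun_prop
  constructor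
  · have h1 : Integrable (fun u : ℝ => u ^ 2)
        ((gaussianReal 0 1).map (fun z => inner ℝ θ μ + σ * ‖θ‖ * z)) :=
      (integrable_map_measure hsq.aestronglyMeasurable hz.aemeasurable).2
        (integrable_sq_affine_gaussianReal _ _)
    rw [← h] at h1
    exact (integrable_map_measure hsq.aestronglyMeasurable
      (measurable_margin θ).aemeasurable).1 h1
  · rw [← integral_sq_affine_gaussianReal,
      ← integral_map (φ := margin θ) (f := fun u => u ^ 2) (measurable_margin θ).aemeasurable
        hsq.aestronglyMeasurable]
    unfold margin
    rw [h, integral_map hz.aemeasurable hsq.aestronglyMeasurable]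

theorem norm_sub_sq_of_mem_Theta {d : ℕ} {θ θ' : E d} (hθ : θ ∈ Theta d) (hθ' : θ' ∈ Theta d) :
    ‖θ - θ'‖ ^ 2 = 2 - 2 * inner ℝ θ θ' := by
  have h1 : ‖θ‖ = 1 := by simpa using hθ
  have h2 : ‖θ'‖ = 1 := by simpa using hθ'
  rw [norm_sub_sq_real, h1, h2]; ring

/-- A localized lower deviation bound for the empirical excess of the ramp loss over the ramp loss
of the Bayes classifier. -/
theorem exists_ramp_excess_deviation {r σ : ℝ} (hr : 0 < r) (hσ : 0 < σ) :
    ∃ κ s : ℝ, 0 < κ ∧ 0 < s ∧ ∀ (d m : ℕ) (μ θ : E d) (τ : ℝ), ‖μ‖ = r → θ ∈ Theta d → 1 ≤ m →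
      (Measure.pi fun _ : Fin m => labeledLaw μ σ)
        {S | (1 / m : ℝ) * ∑ i, (ramp (margin θ (S i)) - ramp (margin (r⁻¹ • μ) (S i)))
          < κ * (r - inner ℝ θ μ) - τ}
        ≤ ENNReal.ofReal (Real.exp (-(m * s * τ))) := by
  obtain ⟨κ, hκ, hgap⟩ := exists_ramp_expectation_gap hr hσ
  set V := 9 * (2 * (r ^ 2 + σ ^ 2) / r) with hV
  have hV0 : 0 < V := by positivity
  -- With sV ≤ κ/2 the variance term is paid by half of the expected gap, so the resulting constant
  -- is κ/2 and the tail in τ is exponential.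
  set s := min 1 (κ / 2 / V) with hs
  have hs0 : 0 < s := by positivity
  refine ⟨κ / 2, s, by positivity, hs0, ?_⟩
  intro d m μ θ τ hμ hθ hm
  set θ₀ := r⁻¹ • μ with hθ₀
  have hθ₀m : θ₀ ∈ Theta d := by
    simp [hθ₀, norm_smul, hμ, abs_of_pos hr, hr.ne']
  have hm0 : (0 : ℝ) < m := by exact_mod_cast hm
  have hin : inner ℝ θ₀ μ = r := by
    rw [hθ₀, real_inner_smul_left, real_inner_self_eq_norm_sq, hμ]; field_simp
  have ha := abs_inner_le_of_mem_Theta hθ hμ.le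
  set a : ℝ := inner ℝ θ μ with hadef
  have har : 0 ≤ r - a := by linarith [le_abs_self a]
  set P := labeledLaw μ σ with hP
  set D : E d × ℝ → ℝ := fun q => ramp (margin θ q) - ramp (margin θ₀ q) with hD
  have hDm : Measurable D := by fun_prop
  have hDi : Integrable D P :=
    (integrable_ramp_comp P (measurable_margin θ)).sub
      (integrable_ramp_comp P (measurable_margin θ₀))
  have hDb : ∀ q, |D q| ≤ 1 := by
    intro q
    rw [abs_le]
    constructor <;> simp only [hD] <;>
    linarith [ramp_nonneg (margin θ q), ramp_nonneg (margin θ₀ q), ramp_le_one (margin θ q),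
      ramp_le_one (margin θ₀ q)]
  set e := ∫ q, D q ∂P with he
  have heq : e = ∫ z, (ramp (a + σ * z) - ramp (r + σ * z)) ∂gaussianReal 0 1 := by
    rw [he, integral_sub (integrable_ramp_comp P (measurable_margin θ))
      (integrable_ramp_comp P (measurable_margin θ₀)),
      integral_sub (integrable_ramp_comp _ (by fun_prop)) (integrable_ramp_comp _ (by fun_prop)),
      integral_comp_margin μ σ hθ measurable_ramp, integral_comp_margin μ σ hθ₀m measurable_ramp,
      hin]
  have he1 : κ * (r - a) ≤ e := (hgap a ha).trans_eq heq.symm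
  have heb : |e| ≤ 1 := by
    rw [he]
    calc |∫ q, D q ∂P| ≤ ∫ q, |D q| ∂P := abs_integral_le_integral_abs
      _ ≤ ∫ _, (1 : ℝ) ∂P := integral_mono hDi.abs (integrable_const _) hDb
      _ = 1 := by simp
  have hD2i : Integrable (fun q => D q ^ 2) P := by
    refine Integrable.of_bound (by fun_prop) 1 (ae_of_all _ fun q => ?_)
    rw [Real.norm_eq_abs, abs_of_nonneg (sq_nonneg _), ← sq_abs]
    exact pow_le_one₀ (abs_nonneg _) (hDb q)
  -- The variance is controlled by the gap itself, which gives the fast rate: the ramp is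
  -- 1-Lipschitz and ‖θ - θ₀‖² = 2(r - a)/r.
  have hD2 : ∫ q, D q ^ 2 ∂P ≤ 2 * (r ^ 2 + σ ^ 2) / r * (r - a) := by
    obtain ⟨h1, h2⟩ := integral_sq_margin μ σ (θ - θ₀)
    have h3 : ∫ q, D q ^ 2 ∂P ≤ ∫ q, margin (θ - θ₀) q ^ 2 ∂P := by
      refine integral_mono hD2i h1 fun q => ?_
      have h4 := abs_ramp_sub_le (margin θ q) (margin θ₀ q)
      have h5 : margin θ q - margin θ₀ q = margin (θ - θ₀) q := by
        simp only [margin, inner_sub_left]; ring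
      rw [h5] at h4
      exact sq_le_sq.2 h4
    rw [h2, mul_pow] at h3
    have h4 : (inner ℝ (θ - θ₀) μ : ℝ) ^ 2 ≤ ‖θ - θ₀‖ ^ 2 * r ^ 2 := by
      rw [← mul_pow, ← hμ]
      exact sq_le_sq.2 ((abs_real_inner_le_norm _ _).trans (le_abs_self _))
    have h5 : ‖θ - θ₀‖ ^ 2 = 2 * (r - a) / r := by
      rw [norm_sub_sq_of_mem_Theta hθ hθ₀m, hθ₀, inner_smul_right, ← hadef]; field_simp
    refine h3.trans ((add_le_add_left h4 _).trans (le_of_eq ?_))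
    rw [h5]; field_simp
  set Y : E d × ℝ → ℝ := fun q => e - D q with hY
  have hYm : Measurable Y := by fun_prop
  have hYi : Integrable Y P := (integrable_const e).sub hDi
  have hY0 : ∫ q, Y q ∂P = 0 := by
    rw [hY, integral_sub (integrable_const e) hDi]; simp [he]
  have hYb : ∀ q, |Y q| ≤ 2 := fun q =>
    (abs_sub _ _).trans (by linarith [hDb q, heb])
  have hexp2 : Real.exp 2 ≤ 9 := by
    have := Real.exp_one_lt_d9
    rw [show (2 : ℝ) = 1 + 1 by norm_num, Real.exp_add]
    nlinarith [Real.exp_pos 1]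
  have hYpt : ∀ q, Y q ^ 2 * Real.exp (1 * |Y q|) ≤ 9 * Y q ^ 2 := by
    intro q
    have : Real.exp (1 * |Y q|) ≤ 9 :=
      (Real.exp_le_exp.2 (by rw [one_mul]; exact hYb q)).trans hexp2
    nlinarith [sq_nonneg (Y q)]
  have hY2i : Integrable (fun q => Y q ^ 2) P := by
    refine Integrable.of_bound (by fun_prop) 4 (ae_of_all _ fun q => ?_)
    rw [Real.norm_eq_abs, abs_of_nonneg (sq_nonneg _), ← sq_abs]
    nlinarith [hYb q, abs_nonneg (Y q)]
  have hYVi : Integrable (fun q => Y q ^ 2 * Real.exp (1 * |Y q|)) P := by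
    refine (hY2i.const_mul 9).mono' (by fun_prop) (ae_of_all _ fun q => ?_)
    rw [Real.norm_eq_abs, abs_of_nonneg (by positivity)]
    exact hYpt q
  have hY2 : ∫ q, Y q ^ 2 ∂P ≤ ∫ q, D q ^ 2 ∂P := by
    have h1 : ∀ q, Y q ^ 2 = (e ^ 2 - 2 * e * D q) + D q ^ 2 := fun q => by simp only [hY]; ring
    have h2 : Integrable (fun q => e ^ 2 - 2 * e * D q) P :=
      (integrable_const _).sub (hDi.const_mul _)
    simp_rw [h1]
    rw [integral_add h2 hD2i, integral_sub (integrable_const _) (hDi.const_mul _),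
      integral_const_mul, ← he]
    simp only [integral_const, probReal_univ, one_smul]
    nlinarith [sq_nonneg e]
  have hYV : ∫ q, Y q ^ 2 * Real.exp (1 * |Y q|) ∂P ≤ V * (r - a) := by
    refine (integral_mono hYVi (hY2i.const_mul 9) hYpt).trans ?_
    rw [integral_const_mul, hV]
    linarith [hY2.trans hD2]
  have hmain := pi_measure_sum_ge_le_of_bernstein hYm hYi hY0 hYVi hYV hs0.le (min_le_left _ _) m
    (m * (κ / 2 * (r - a) + τ))
  refine (measure_mono ?_).trans (hmain.trans (ENNReal.ofReal_le_ofReal (Real.exp_le_exp.2 ?_)))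
  · intro S hS
    simp only [Set.mem_ofPred_eq] at hS ⊢
    have h1 : ∑ i, Y (S i) = m * (e - (1 / m : ℝ) * ∑ i, D (S i)) := by
      simp only [hY]
      rw [Finset.sum_sub_distrib, Finset.sum_const, Finset.card_univ, Fintype.card_fin,
        nsmul_eq_mul]
      field_simp
    rw [h1]
    gcongr
    change (1 / m : ℝ) * ∑ i, D (S i) < _ at hS
    linarith
  · have h1 : s * V ≤ κ / 2 := by
      have := min_le_right 1 (κ / 2 / V)
      rw [← hs, le_div_iff₀ hV0] at this
      exact this
    have h2 : m * (s ^ 2 * (V * (r - a))) ≤ m * s * (κ / 2) * (r - a) := by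
      have : m * s * (r - a) * (s * V) ≤ m * s * (r - a) * (κ / 2) := by gcongr
      linarith
    linarith

/-! ### Excess risk in terms of the mean margin. -/

/-- The risk of a linear classifier in terms of the mean of its margin. -/
theorem risk_labeledLaw {d : ℕ} (μ : E d) (σ : ℝ) {θ : E d} (hθ : θ ∈ Theta d) :
    risk (labeledLaw μ σ) θ
      = (gaussianReal 0 1).real {z | inner ℝ θ μ + σ * z ≤ 0} := by
  have hF : Measurable fun u : ℝ => if u ≤ 0 then (1 : ℝ) else 0 :=
    Measurable.ite measurableSet_Iic measurable_const measurable_const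
  have hs : MeasurableSet {z : ℝ | inner ℝ θ μ + σ * z ≤ 0} :=
    measurableSet_le (by fun_prop) (by fun_prop)
  have h1 := integral_comp_margin μ σ hθ hF
  unfold risk loss
  unfold margin at h1
  rw [h1, ← integral_indicator_one hs]
  rfl

/-- The risk is a normal distribution function evaluated at -⟨θ, μ⟩/σ, and the normal density is at
most 1. The infimum is only bounded below, by the value at mean margin r. -/
theorem excessRisk_le {d : ℕ} {μ : E d} {r σ : ℝ} (hσ : 0 < σ) (hμ : ‖μ‖ = r) {θ : E d}
    (hθ : θ ∈ Theta d) : excessRisk (labeledLaw μ σ) θ ≤ (r - inner ℝ θ μ) / σ := by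
  have hne : Nonempty (Theta d) := ⟨⟨θ, hθ⟩⟩
  have hle : ∀ θ' ∈ Theta d, inner ℝ θ' μ ≤ r := fun θ' h =>
    (le_abs_self _).trans (abs_inner_le_of_mem_Theta h hμ.le)
  have h1 : (gaussianReal 0 1).real {z | r + σ * z ≤ 0}
      ≤ ⨅ θ' : Theta d, risk (labeledLaw μ σ) (θ' : E d) := by
    refine le_ciInf fun θ' => ?_
    rw [risk_labeledLaw μ σ θ'.2]
    refine measureReal_mono fun z hz => ?_
    simp only [Set.mem_ofPred_eq] at hz ⊢
    linarith [hle θ' θ'.2]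
  have h2 : risk (labeledLaw μ σ) θ ≤ (gaussianReal 0 1).real {z | r + σ * z ≤ 0}
      + (r - inner ℝ θ μ) / σ := by
    rw [risk_labeledLaw μ σ hθ]
    have hsub : {z | inner ℝ θ μ + σ * z ≤ 0} ⊆ {z | r + σ * z ≤ 0}
        ∪ Set.Ioc (-r / σ) (-inner ℝ θ μ / σ) := by
      intro z hz
      simp only [Set.mem_union, Set.mem_ofPred_eq, Set.mem_Ioc] at hz ⊢
      by_cases h : r + σ * z ≤ 0
      · exact Or.inl h
      · right
        rw [div_lt_iff₀ hσ, le_div_iff₀ hσ]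
        constructor <;> nlinarith
    refine (measureReal_mono hsub).trans ((measureReal_union_le _ _).trans ?_)
    gcongr
    refine (real_gaussianReal_Ioc_le (by gcongr; linarith [hle θ hθ])).trans (le_of_eq ?_)
    ring
  unfold excessRisk
  linarith

theorem excessRisk_le_one {d : ℕ} (μ : E d) (σ : ℝ) {θ : E d} (hθ : θ ∈ Theta d) :
    excessRisk (labeledLaw μ σ) θ ≤ 1 := by
  have h1 : 0 ≤ ⨅ θ' : Theta d, risk (labeledLaw μ σ) (θ' : E d) :=
    Real.iInf_nonneg fun θ' => by
      rw [risk_labeledLaw μ σ θ'.2]; exact measureReal_nonneg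
  have h2 : risk (labeledLaw μ σ) θ ≤ 1 := by
    rw [risk_labeledLaw μ σ hθ]; exact measureReal_le_one
  unfold excessRisk
  linarith

/-! ### Closed forms of the robust losses. -/

theorem loss_nonneg {d : ℕ} (x : E d) (y : ℝ) (θ : E d) : 0 ≤ loss x y θ := by
  unfold loss; split_ifs <;> norm_num

/-- The cheapest way to an error is projection onto the decision hyperplane, whose cost is the
margin. Boundary points count as errors, so the supremum is attained there. -/
theorem robustLoss_cost {d : ℕ} {θ : E d} (hθ : θ ∈ Theta d) (x : E d) {y : ℝ}
    (hy : y = 1 ∨ y = -1) : robustLoss cost 1 x y θ = ramp (margin θ (x, y)) := by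
  have h1 : ‖θ‖ = 1 := by simpa using hθ
  have hy2 : y * y = 1 := by rcases hy with rfl | rfl <;> norm_num
  have hya : |y| = 1 := by rcases hy with rfl | rfl <;> norm_num
  unfold robustLoss cost
  simp only [NNReal.coe_one, one_mul]
  set u := margin θ (x, y) with hu
  have hu' : u = y * inner ℝ θ x := rfl
  have hub : ∀ z : E d, loss z y θ - ‖z - x‖ ≤ ramp u := by
    intro z
    unfold loss
    split_ifs with h
    · have h2 : y * inner ℝ θ x - y * inner ℝ θ z ≤ ‖z - x‖ := by
        rw [← mul_sub, ← inner_sub_right, ← real_inner_smul_left]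
        refine (real_inner_le_norm _ _).trans (le_of_eq ?_)
        rw [norm_smul, h1, Real.norm_eq_abs, hya, norm_sub_rev]; ring
      refine le_max_of_le_right (le_min ?_ ?_) <;> linarith [norm_nonneg (z - x)]
    · exact le_max_of_le_left (by linarith [norm_nonneg (z - x)])
  have hbdd : BddAbove (Set.range fun z : E d => loss z y θ - ‖z - x‖) :=
    ⟨ramp u, by rintro _ ⟨z, rfl⟩; exact hub z⟩
  apply le_antisymm (ciSup_le hub)
  have hx := le_ciSup hbdd x
  simp only [sub_self, norm_zero, sub_zero] at hx
  refine max_le ((loss_nonneg _ _ _).trans hx) ?_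
  rcases le_or_gt u 0 with h | h
  · refine (min_le_left _ _).trans (le_trans (le_of_eq ?_) hx)
    unfold loss
    rw [if_pos (by rwa [← hu'])]
  · refine (min_le_right _ _).trans (le_trans (le_of_eq ?_) (le_ciSup hbdd (x - (u * y) • θ)))
    have h2 : y * inner ℝ θ (x - (u * y) • θ) = 0 := by
      rw [inner_sub_right, inner_smul_right, real_inner_self_eq_norm_sq, h1]
      linear_combination (-u) * hy2 - hu'
    simp only [loss]
    rw [if_pos h2.le, sub_sub_cancel_left, norm_neg, norm_smul, h1, Real.norm_eq_abs, abs_mul,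
      hya, abs_of_pos h]
    ring

/-- With the assigned pseudo-label, an error requires reaching the hyperplane, at squared distance
⟨θ, x⟩². The hypothesis on γ makes this move worthwhile, so no truncation occurs and the loss is
affine in ⟨θ, x⟩². -/
theorem robustLoss_costSq {d : ℕ} {θ : E d} (hθ : θ ∈ Theta d) (x : E d) {γ : ℝ≥0}
    (hγ : γ * (inner ℝ θ x : ℝ) ^ 2 ≤ 1) :
    robustLoss costSq γ x (classify θ x) θ = 1 - γ * (inner ℝ θ x : ℝ) ^ 2 := by
  have h1 : ‖θ‖ = 1 := by simpa using hθ
  unfold robustLoss costSq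
  have hub : ∀ z : E d, loss z (classify θ x) θ - γ * ‖z - x‖ ^ 2
      ≤ 1 - γ * (inner ℝ θ x : ℝ) ^ 2 := by
    intro z
    have hγ0 : (0 : ℝ) ≤ γ := γ.2
    by_cases h : classify θ x * inner ℝ θ z ≤ 0
    · rw [loss, if_pos h]
      have h3 : |inner ℝ θ x| ≤ ‖z - x‖ := by
        have h4 : |inner ℝ θ (z - x)| ≤ ‖z - x‖ := by
          have := abs_real_inner_le_norm θ (z - x)
          rwa [h1, one_mul] at this
        rw [inner_sub_right] at h4
        refine le_trans ?_ h4
        unfold classify at h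
        split_ifs at h with h5
        · rw [abs_of_nonneg h5, abs_sub_comm]
          exact le_trans (by linarith) (le_abs_self _)
        · rw [abs_of_neg (not_le.1 h5)]
          exact le_trans (by linarith) (le_abs_self _)
      have h4 : (inner ℝ θ x : ℝ) ^ 2 ≤ ‖z - x‖ ^ 2 := by
        rw [← sq_abs]; gcongr
      nlinarith
    · rw [loss, if_neg h]
      nlinarith [sq_nonneg ‖z - x‖]
  have hbdd : BddAbove (Set.range fun z : E d => loss z (classify θ x) θ - γ * ‖z - x‖ ^ 2) :=
    ⟨_, by rintro _ ⟨z, rfl⟩; exact hub z⟩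
  apply le_antisymm (ciSup_le hub)
  refine le_trans (le_of_eq ?_) (le_ciSup hbdd (x - (inner ℝ θ x : ℝ) • θ))
  have h2 : inner ℝ θ (x - (inner ℝ θ x : ℝ) • θ) = 0 := by
    rw [inner_sub_right, inner_smul_right, real_inner_self_eq_norm_sq, h1]; ring
  simp only [loss]
  rw [h2, if_pos (by simp), sub_sub_cancel_left, norm_neg, norm_smul, h1, Real.norm_eq_abs,
    mul_one, sq_abs]

/-! ### The parameter rule and the objective it produces. -/

/-- One plus the sum of the squared norms of a sample. -/
noncomputable def normSum {d n : ℕ} (X : Fin n → E d) : ℝ≥0 := 1 + ∑ j, ‖X j‖₊ ^ 2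

/-- The rule that calculates the RSS parameters: the robust loss of the labeled points alone for
`d ^ 3 < m`, and otherwise a choice that makes the unlabeled part a large multiple of the empirical
second moment in the direction `θ`. -/
noncomputable def paramRule : ParamRule := fun d m n _ S =>
  -- The threshold d³ is what makes d log m = O(√m) in the first case. In the second, `normSum`
  -- dominates every squared projection, so γ' causes no truncation, and the third parameter cancels
  -- both 1/n and γ'.
  if d ^ 3 < m then (1, 0, 0) else (1, (normSum S.2)⁻¹, n * normSum S.2)

theorem measurable_paramRule (d m n : ℕ) (δ : ℝ) : Measurable (paramRule d m n δ) := by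
  unfold paramRule normSum
  split_ifs <;> fun_prop

/-- The empirical ramp loss of the labeled points. -/
noncomputable def empRamp {d m : ℕ} (S : Fin m → E d × ℝ) (θ : E d) : ℝ :=
  (1 / m : ℝ) * ∑ i, ramp (margin θ (S i))

theorem avg_ramp_sub_eq {d m : ℕ} (S : Fin m → E d × ℝ) (θ θ' : E d) :
    (1 / m : ℝ) * ∑ i, (ramp (margin θ (S i)) - ramp (margin θ' (S i)))
      = empRamp S θ - empRamp S θ' := by
  rw [Finset.sum_sub_distrib, mul_sub, empRamp, empRamp]

theorem continuous_empRamp {d m : ℕ} (S : Fin m → E d × ℝ) : Continuous (empRamp S) := by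
  have : ∀ i, Continuous fun θ : E d => ramp (margin θ (S i)) := fun i =>
    continuous_ramp.comp (by unfold margin; fun_prop)
  unfold empRamp
  fun_prop

theorem empRamp_nonneg {d m : ℕ} (S : Fin m → E d × ℝ) (θ : E d) : 0 ≤ empRamp S θ :=
  mul_nonneg (by positivity) (Finset.sum_nonneg fun _ _ => ramp_nonneg _)

theorem empRamp_le_one {d m : ℕ} (S : Fin m → E d × ℝ) (θ : E d) : empRamp S θ ≤ 1 := by
  unfold empRamp
  rw [one_div_mul_eq_div]
  apply div_le_one_of_le₀ _ (by positivity)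
  refine (Finset.sum_le_sum fun i _ => ramp_le_one (margin θ (S i))).trans (le_of_eq ?_)
  simp

theorem objective_paramRule_of_lt {d m n : ℕ} {δ : ℝ} (S : Samples d m n)
    (hS : ∀ i, (S.1 i).2 = 1 ∨ (S.1 i).2 = -1) (h : d ^ 3 < m) {θ : E d} (hθ : θ ∈ Theta d) :
    objective (paramRule d m n δ S) S θ = empRamp S.1 θ := by
  have h1 : ∀ i, robustLoss cost 1 (S.1 i).1 (S.1 i).2 θ = ramp (margin θ (S.1 i)) :=
    fun i => robustLoss_cost hθ _ (hS i)
  simp [objective, paramRule, h, h1, empRamp]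

theorem objective_paramRule_of_le {d m n : ℕ} {δ : ℝ} (S : Samples d m n)
    (hS : ∀ i, (S.1 i).2 = 1 ∨ (S.1 i).2 = -1) (h : m ≤ d ^ 3) {θ : E d} (hθ : θ ∈ Theta d) :
    objective (paramRule d m n δ S) S θ
      = empRamp S.1 θ + (n * normSum S.2 - ∑ j, (inner ℝ θ (S.2 j) : ℝ) ^ 2) := by
  have hθ1 : ‖θ‖ = 1 := by simpa using hθ
  have h1 : ∀ i, robustLoss cost 1 (S.1 i).1 (S.1 i).2 θ = ramp (margin θ (S.1 i)) :=
    fun i => robustLoss_cost hθ _ (hS i)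
  set q := normSum S.2 with hq
  have hq0 : 0 < (q : ℝ) := by
    have : 0 < q := by rw [hq, normSum]; positivity
    exact_mod_cast this
  have hle : ∀ j, (inner ℝ θ (S.2 j) : ℝ) ^ 2 ≤ q := by
    intro j
    have h2 : |inner ℝ θ (S.2 j)| ≤ ‖S.2 j‖ := by
      have := abs_real_inner_le_norm θ (S.2 j)
      rwa [hθ1, one_mul] at this
    have h3 : (inner ℝ θ (S.2 j) : ℝ) ^ 2 ≤ ‖S.2 j‖ ^ 2 := by
      rw [← sq_abs]; gcongr
    have h4 : ‖S.2 j‖ ^ 2 ≤ ∑ j, ‖S.2 j‖ ^ 2 :=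
      Finset.single_le_sum (f := fun j => ‖S.2 j‖ ^ 2) (fun _ _ => sq_nonneg _)
        (Finset.mem_univ j)
    rw [hq, normSum]
    push_cast
    linarith
  have h2 : ∀ j, robustLoss costSq q⁻¹ (S.2 j) (classify θ (S.2 j)) θ
      = 1 - (q : ℝ)⁻¹ * (inner ℝ θ (S.2 j) : ℝ) ^ 2 := by
    intro j
    rw [robustLoss_costSq hθ, NNReal.coe_inv]
    rw [NNReal.coe_inv, inv_mul_le_one₀ hq0]
    exact hle j
  unfold objective paramRule
  rw [if_neg (not_lt.2 h)]
  simp only [h1, ← hq, h2, empRamp]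
  congr 1
  rw [Finset.sum_sub_distrib, ← Finset.mul_sum]
  rcases Nat.eq_zero_or_pos n with rfl | hn
  · simp
  · have hn0 : (n : ℝ) ≠ 0 := by positivity
    simp
    field_simp

/-- On the sphere, which is compact and for d ≥ 1 nonempty, the objective agrees with a continuous
function. -/
theorem exists_isRSSEstimator {d m n : ℕ} {δ : ℝ} (hd : 1 ≤ d) (S : Samples d m n)
    (hS : ∀ i, (S.1 i).2 = 1 ∨ (S.1 i).2 = -1) :
    ∃ θ, IsRSSEstimator (paramRule d m n δ S) S θ := by
  have hne : (Theta d).Nonempty := ⟨EuclideanSpace.single ⟨0, hd⟩ 1, by simp⟩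
  have hc : ContinuousOn (objective (paramRule d m n δ S) S) (Theta d) := by
    rcases lt_or_ge (d ^ 3) m with h | h
    · exact (continuous_empRamp S.1).continuousOn.congr fun θ hθ =>
        objective_paramRule_of_lt S hS h hθ
    · have hcont := continuous_empRamp S.1
      have : Continuous fun θ : E d => empRamp S.1 θ
          + (n * normSum S.2 - ∑ j, (inner ℝ θ (S.2 j) : ℝ) ^ 2) := by fun_prop
      exact this.continuousOn.congr fun θ hθ => objective_paramRule_of_le S hS h hθ
  obtain ⟨θ, hθ, hmin⟩ := (isCompact_sphere (0 : E d) 1).exists_isMinOn hne hc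
  exact ⟨θ, hθ, fun θ' hθ' => hmin hθ'⟩

/-! ### Deterministic estimates for minimizers. -/

/-- Cauchy–Schwarz for the 1-Lipschitz ramp. The Lipschitz constant comes from directional second
moments and not from the norms of the points, which would bring in a larger dependence on d. -/
theorem abs_empRamp_sub_le {d m : ℕ} (S : Fin m → E d × ℝ) {Q : ℝ}
    (hQ : ∀ u ∈ Theta d, (1 / m : ℝ) * ∑ i, margin u (S i) ^ 2 ≤ Q) (θ θ' : E d) :
    |empRamp S θ - empRamp S θ'| ≤ ‖θ - θ'‖ * √Q := by
  set v := θ - θ' with hv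
  have h1 : |empRamp S θ - empRamp S θ'| ≤ (1 / m : ℝ) * ∑ i, |margin v (S i)| := by
    unfold empRamp
    rw [← mul_sub, ← Finset.sum_sub_distrib, abs_mul,
      abs_of_nonneg (by positivity : (0 : ℝ) ≤ 1 / m)]
    gcongr
    refine (Finset.abs_sum_le_sum_abs _ _).trans (Finset.sum_le_sum fun i _ => ?_)
    refine (abs_ramp_sub_le _ _).trans (le_of_eq ?_)
    congr 1
    simp only [margin, hv, inner_sub_left]; ring
  have h2 : ((1 / m : ℝ) * ∑ i, |margin v (S i)|) ^ 2
      ≤ (1 / m : ℝ) * ∑ i, margin v (S i) ^ 2 := by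
    have h3 := sq_sum_le_card_mul_sum_sq (s := Finset.univ) (f := fun i => |margin v (S i)|)
    simp only [sq_abs, Finset.card_univ, Fintype.card_fin] at h3
    rcases Nat.eq_zero_or_pos m with rfl | hm
    · simp
    · have hm0 : (0 : ℝ) < m := by exact_mod_cast hm
      rw [mul_pow]
      calc (1 / m : ℝ) ^ 2 * (∑ i, |margin v (S i)|) ^ 2
          ≤ (1 / m : ℝ) ^ 2 * (m * ∑ i, margin v (S i) ^ 2) := by gcongr
        _ = (1 / m : ℝ) * ∑ i, margin v (S i) ^ 2 := by field_simp
  have h3 : (1 / m : ℝ) * ∑ i, margin v (S i) ^ 2 ≤ ‖v‖ ^ 2 * Q := by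
    by_cases hv0 : v = 0
    · simp [hv0, margin]
    · have hn : ‖v‖ ≠ 0 := norm_ne_zero_iff.2 hv0
      have h4 := hQ (‖v‖⁻¹ • v) (by simp [norm_smul, hn])
      have h5 : ∀ i, margin v (S i) ^ 2 = ‖v‖ ^ 2 * margin (‖v‖⁻¹ • v) (S i) ^ 2 := by
        intro i
        simp only [margin, real_inner_smul_left]
        field_simp
      simp_rw [h5]
      rw [← Finset.mul_sum, mul_left_comm]
      gcongr
  have h4 := Real.le_sqrt_of_sq_le (h2.trans h3)
  rw [Real.sqrt_mul (sq_nonneg _), Real.sqrt_sq (norm_nonneg _)] at h4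
  exact h1.trans h4

theorem inv_smul_mem_Theta {d : ℕ} {μ : E d} {r : ℝ} (hr : 0 < r) (hμ : ‖μ‖ = r) :
    r⁻¹ • μ ∈ Theta d := by
  simp [norm_smul, hμ, abs_of_pos hr, hr.ne']

/-- A near-minimizer of the empirical ramp loss is close to the Bayes classifier if the empirical
excess loss is controlled on a net. -/
theorem sub_inner_le_of_net {d m : ℕ} (S : Fin m → E d × ℝ) {μ : E d} {r κ τ s Q : ℝ}
    (hμ : ‖μ‖ = r) (hκ : 0 < κ)
    (hQ : ∀ u ∈ Theta d, (1 / m : ℝ) * ∑ i, margin u (S i) ^ 2 ≤ Q) {T : Finset (E d)}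
    (hnet : ∀ x ∈ Theta d, ∃ y ∈ T, ‖x - y‖ ≤ s)
    (hdev : ∀ y ∈ T, κ * (r - inner ℝ y μ) - τ
      ≤ (1 / m : ℝ) * ∑ i, (ramp (margin y (S i)) - ramp (margin (r⁻¹ • μ) (S i))))
    {θ : E d} (hθ : θ ∈ Theta d) (hle : empRamp S θ ≤ empRamp S (r⁻¹ • μ)) :
    r - inner ℝ θ μ ≤ (τ + s * √Q) / κ + s * r := by
  obtain ⟨y, hy, hxy⟩ := hnet θ hθ
  have h1 := hdev y hy
  rw [avg_ramp_sub_eq] at h1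
  have h2 := (abs_le.1 (abs_empRamp_sub_le S hQ θ y)).1
  have h3 : ‖θ - y‖ * √Q ≤ s * √Q := by gcongr
  have h4 : inner ℝ y μ - inner ℝ θ μ ≤ s * r := by
    rw [← inner_sub_left, ← hμ]
    refine (real_inner_le_norm _ _).trans ?_
    rw [norm_sub_rev]; gcongr
  have h5 : r - inner ℝ y μ ≤ (τ + s * √Q) / κ := by
    rw [le_div_iff₀ hκ]; linarith
  linarith

/-- If the unlabeled second moments concentrate and the labeled data determine the sign of the
classifier, then RSS training for `m ≤ d ^ 3` is close to the Bayes classifier. -/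
theorem sub_inner_le_of_moments {d m n : ℕ} {δ : ℝ} (S : Samples d m n)
    (hS : ∀ i, (S.1 i).2 = 1 ∨ (S.1 i).2 = -1) (h : m ≤ d ^ 3) (hn : 1 ≤ n) {μ₀ μ₁ : E d}
    {r σ₁ κ Q e β η : ℝ} (hr : 0 < r) (hμ : ‖μ₀‖ = r) (hκ : 0 < κ)
    (hQ : ∀ u ∈ Theta d, (1 / m : ℝ) * ∑ i, margin u (S.1 i) ^ 2 ≤ Q) (hQ0 : 0 ≤ Q)
    (hdev : κ * (r - inner ℝ (-(r⁻¹ • μ₀)) μ₀) - κ * r ≤ (1 / m : ℝ) *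
      ∑ i, (ramp (margin (-(r⁻¹ • μ₀)) (S.1 i)) - ramp (margin (r⁻¹ • μ₀) (S.1 i))))
    (hmom : ∀ u ∈ Theta d, |(1 / n : ℝ) * ∑ j, inner ℝ u (S.2 j) ^ 2
      - (inner ℝ u μ₁ ^ 2 + σ₁ ^ 2)| ≤ e)
    (hβ : ‖μ₀ - μ₁‖ ≤ β) (hη : η = 2 * e + 1 / n + 2 * (β * (2 * r + β)))
    (hsmall : 8 * η * Q < κ ^ 2 * r ^ 4)
    {θ : E d} (hθ : IsRSSEstimator (paramRule d m n δ S) S θ) :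
    r - inner ℝ θ μ₀ ≤ η / r := by
  obtain ⟨hθm, hmin⟩ := hθ
  set θ₀ := r⁻¹ • μ₀ with hθ₀
  have hθ₀m : θ₀ ∈ Theta d := inv_smul_mem_Theta hr hμ
  have hn0 : (0 : ℝ) < n := by exact_mod_cast hn
  have hin : inner ℝ θ₀ μ₀ = r := by
    rw [hθ₀, real_inner_smul_left, real_inner_self_eq_norm_sq, hμ]; field_simp
  have ha := abs_inner_le_of_mem_Theta hθm hμ.le
  set a : ℝ := inner ℝ θ μ₀ with hadef
  have hshift : ∀ u ∈ Theta d, |(inner ℝ u μ₁ : ℝ) ^ 2 - inner ℝ u μ₀ ^ 2|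
      ≤ β * (2 * r + β) := by
    intro u hu
    have h1 : |inner ℝ u (μ₀ - μ₁)| ≤ β := abs_inner_le_of_mem_Theta hu hβ
    have h2 : |inner ℝ u μ₀| ≤ r := abs_inner_le_of_mem_Theta hu hμ.le
    rw [inner_sub_right] at h1
    have h3 : (inner ℝ u μ₁ : ℝ) ^ 2 - inner ℝ u μ₀ ^ 2
        = (inner ℝ u μ₀ - inner ℝ u μ₁) * (-(2 * inner ℝ u μ₀)
          + (inner ℝ u μ₀ - inner ℝ u μ₁)) := by ring
    have hβ0 : 0 ≤ β := (norm_nonneg _).trans hβ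
    rw [h3, abs_mul]
    gcongr
    have h4 := abs_add_le (-(2 * (inner ℝ u μ₀ : ℝ))) (inner ℝ u μ₀ - inner ℝ u μ₁)
    rw [abs_neg, abs_mul, abs_two] at h4
    linarith
  -- Comparison with θ₀: the labeled term lies in [0, 1] and costs at most 1/n after averaging,
  -- while σ₁² cancels between the two directions.
  have hquad : r ^ 2 - a ^ 2 ≤ η := by
    have h1 := hmin θ₀ hθ₀m
    rw [objective_paramRule_of_le S hS h hθm, objective_paramRule_of_le S hS h hθ₀m] at h1
    have h2 : ∑ j, (inner ℝ θ₀ (S.2 j) : ℝ) ^ 2 - ∑ j, (inner ℝ θ (S.2 j) : ℝ) ^ 2 ≤ 1 := by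
      linarith [empRamp_nonneg S.1 θ, empRamp_le_one S.1 θ₀]
    have h3 : (1 / n : ℝ) * ∑ j, (inner ℝ θ₀ (S.2 j) : ℝ) ^ 2
        - (1 / n : ℝ) * ∑ j, (inner ℝ θ (S.2 j) : ℝ) ^ 2 ≤ 1 / n := by
      rw [← mul_sub]
      exact mul_le_of_le_one_right (by positivity) h2
    have h4 := (abs_le.1 (hmom θ hθm)).2
    have h5 := (abs_le.1 (hmom θ₀ hθ₀m)).1
    have h6 := (abs_le.1 (hshift θ hθm)).2
    have h7 := (abs_le.1 (hshift θ₀ hθ₀m)).1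
    rw [hin] at h7
    rw [hη]
    linarith
  obtain ⟨ha1, ha2⟩ := abs_le.1 ha
  rcases le_or_gt 0 a with ha0 | ha0
  · rw [le_div_iff₀ hr]
    nlinarith
  -- The unlabeled term is even, so optimality against -θ says that the ramp loss prefers θ. But a <
  -- 0 puts θ within D of -θ₀, with D² ≤ 2η/r², and there the tested gap κr between -θ₀ and θ₀
  -- survives the Lipschitz error 2D√Q.
  · exfalso
    have hneg : -θ ∈ Theta d := by simpa using hθm
    have h1 := hmin (-θ) hneg
    rw [objective_paramRule_of_le S hS h hθm, objective_paramRule_of_le S hS h hneg] at h1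
    simp only [inner_neg_left, neg_sq] at h1
    have h2 := (abs_le.1 (abs_empRamp_sub_le S.1 hQ θ (-θ₀))).1
    have h3 := (abs_le.1 (abs_empRamp_sub_le S.1 hQ (-θ) θ₀)).2
    rw [show -θ - θ₀ = -(θ - -θ₀) by abel, norm_neg] at h3
    rw [avg_ramp_sub_eq] at hdev
    rw [inner_neg_left, hin] at hdev
    set D := ‖θ - -θ₀‖ with hD
    have h4 : κ * r ≤ 2 * (D * √Q) := by linarith
    have h5 : D ^ 2 * r = 2 * (r + a) := by
      rw [hD, norm_sub_sq_of_mem_Theta hθm (by simpa using hθ₀m), inner_neg_right, hθ₀,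
        inner_smul_right, ← hadef]
      field_simp; ring
    have h6 : (r + a) * r ≤ η := by nlinarith
    have h7 : (κ * r) ^ 2 ≤ 4 * (D ^ 2 * Q) := by
      have h8 : (κ * r) ^ 2 ≤ (2 * (D * √Q)) ^ 2 := pow_le_pow_left₀ (by positivity) h4 2
      rw [mul_pow 2, mul_pow D, Real.sq_sqrt hQ0] at h8
      linarith
    have h9 : κ ^ 2 * r ^ 4 ≤ 8 * ((r + a) * r) * Q := by
      calc κ ^ 2 * r ^ 4 = (κ * r) ^ 2 * r ^ 2 := by ring
        _ ≤ 4 * (D ^ 2 * Q) * r ^ 2 := by gcongr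
        _ = 4 * (D ^ 2 * r) * r * Q := by ring
        _ = 8 * ((r + a) * r) * Q := by rw [h5]; ring
    have h10 : 8 * ((r + a) * r) * Q ≤ 8 * η * Q := by gcongr
    linarith

/-! ### High-probability bounds in the two regimes. -/

theorem map_sq_inner_labeledLaw_of_mem_Theta {d : ℕ} (μ : E d) (σ : ℝ) {θ : E d}
    (hθ : θ ∈ Theta d) :
    (labeledLaw μ σ).map (fun q => (inner ℝ θ (q.2 • q.1)) ^ 2)
      = (gaussianReal 0 1).map (fun z => (inner ℝ θ μ + σ * z) ^ 2) := by
  have h1 : ‖θ‖ = 1 := by simpa using hθ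
  rw [map_sq_inner_labeledLaw, h1, mul_one]

theorem map_sq_inner_unlabeledLaw_of_mem_Theta {d : ℕ} (μ : E d) (σ : ℝ) {θ : E d}
    (hθ : θ ∈ Theta d) :
    (unlabeledLaw μ σ).map (fun x => (inner ℝ θ x) ^ 2)
      = (gaussianReal 0 1).map (fun z => (inner ℝ θ μ + σ * z) ^ 2) := by
  have h1 : ‖θ‖ = 1 := by simpa using hθ
  rw [map_sq_inner_unlabeledLaw, h1, mul_one]

/-- A uniform upper bound for the empirical second moments of the margins. -/
theorem exists_margin_moment_bound {r σ : ℝ} (hr : 0 < r) (hσ : 0 < σ) :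
    ∃ C : ℝ, 0 < C ∧ ∀ (d m : ℕ) (μ : E d) (t : ℝ), ‖μ‖ = r → 1 ≤ d → 1 ≤ m → 0 ≤ t →
      (Measure.pi fun _ : Fin m => labeledLaw μ σ)
        {S | ¬ ∀ u ∈ Theta d, (1 / m : ℝ) * ∑ i, margin u (S i) ^ 2 ≤ C * (1 + (d + t) / m)}
        ≤ ENNReal.ofReal (Real.exp (-t)) := by
  obtain ⟨C, hC, hdev⟩ := exists_uniform_moment_deviation (M := r + σ + 1) (by linarith)
  refine ⟨r ^ 2 + σ ^ 2 + 2 * C, by positivity, ?_⟩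
  intro d m μ t hμ hd hm ht
  have hm0 : (0 : ℝ) < m := by exact_mod_cast hm
  set ρ : ℝ := (d + t) / m with hρ
  have hρ0 : 0 ≤ ρ := by positivity
  have h := hdev (labeledLaw μ σ) d m (fun q => q.2 • q.1) μ σ t (√ρ) (by fun_prop)
    (by linarith) (by rw [abs_of_pos hσ]; linarith)
    (fun θ hθ => map_sq_inner_labeledLaw_of_mem_Theta μ σ hθ) hd hm ht (Real.sqrt_nonneg _)
    (by rw [Real.sq_sqrt hρ0, hρ]; field_simp)
  refine (measure_mono ?_).trans h
  intro S hS hcon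
  refine hS fun u hu => ?_
  have h1 := (abs_le.1 (hcon u hu)).2
  simp only [← margin_eq_inner] at h1
  have h2 : (inner ℝ u μ : ℝ) ^ 2 ≤ r ^ 2 := by
    rw [← sq_abs]; gcongr; exact abs_inner_le_of_mem_Theta hu hμ.le
  rw [Real.sq_sqrt hρ0] at h1
  have h3 : √ρ ≤ 1 + ρ := by
    rw [Real.sqrt_le_left (by positivity)]; nlinarith
  have h4 : C * (√ρ + ρ) ≤ 2 * C * (1 + ρ) := by nlinarith
  nlinarith [mul_nonneg (show 0 ≤ r ^ 2 + σ ^ 2 by positivity) hρ0]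

/-- The logarithm is at most three times the cube root of its argument, and m^(1/3) · m^(1/6) = √m.
This is where the exponent 3 of the rule enters. -/
theorem mul_log_le_sqrt {d m : ℕ} (hm : 1 ≤ m) (h : d ^ 3 < m) :
    d * Real.log (3 * √m) ≤ 6 * √m := by
  have hm0 : (0 : ℝ) < m := by exact_mod_cast hm
  have h1 := Real.log_le_rpow_div (x := 3 * √m) (ε := 1 / 3) (by positivity) (by norm_num)
  set z := (3 * √m) ^ (1 / 3 : ℝ) with hz
  have hz0 : 0 ≤ z := by positivity
  have hz3 : z ^ 3 = 3 * √m := by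
    rw [hz, ← Real.rpow_natCast, ← Real.rpow_mul (by positivity)]; norm_num
  have hd3 : (d : ℝ) ^ 3 ≤ m := by exact_mod_cast h.le
  have h2 : (d * z) ^ 3 ≤ (2 * √m) ^ 3 := by
    have h3 : √(m : ℝ) ^ 3 = m * √m := by rw [pow_succ, Real.sq_sqrt hm0.le]
    rw [mul_pow, mul_pow, hz3, h3]
    nlinarith [mul_le_mul_of_nonneg_right hd3 (Real.sqrt_nonneg (m : ℝ)),
      mul_nonneg hm0.le (Real.sqrt_nonneg (m : ℝ))]
  have h3 : d * z ≤ 2 * √m := le_of_pow_le_pow_left₀ (by norm_num) (by positivity) h2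
  have h4 : (d : ℝ) * Real.log (3 * √m) ≤ d * (z / (1 / 3)) := by gcongr
  linarith

/-- The fast rate of ramp loss minimization in low dimension. -/
theorem exists_low_dimension_bound {r σ : ℝ} (hr : 0 < r) (hσ : 0 < σ) :
    ∃ C : ℝ, 0 < C ∧ ∀ (d m : ℕ) (μ : E d) (t : ℝ), ‖μ‖ = r → 1 ≤ d → 1 ≤ m → d ^ 3 < m →
      0 ≤ t → t ≤ m →
      (Measure.pi fun _ : Fin m => labeledLaw μ σ)
        {S | ¬ ∀ θ ∈ Theta d, empRamp S θ ≤ empRamp S (r⁻¹ • μ) →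
          r - inner ℝ θ μ ≤ C * √((1 + t) / m)}
        ≤ ENNReal.ofReal (2 * Real.exp (-t)) := by
  obtain ⟨C₁, hC₁, hmom⟩ := exists_margin_moment_bound hr hσ
  obtain ⟨κ, s₁, hκ, hs₁, hdev⟩ := exists_ramp_excess_deviation hr hσ
  refine ⟨(7 / s₁ + √(C₁ * 3)) / κ + r, by positivity, ?_⟩
  intro d m μ t hμ hd hm hdm ht htm
  have hm0 : (0 : ℝ) < m := by exact_mod_cast hm
  have hm1 : (1 : ℝ) ≤ m := by exact_mod_cast hm
  have hsq : 1 ≤ √(m : ℝ) := Real.one_le_sqrt.2 hm1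
  have hsqm : √(m : ℝ) * √m = m := Real.mul_self_sqrt hm0.le
  -- At this scale the discretization error is of the order of the target rate.
  obtain ⟨T, hT, hcard, hnet⟩ := exists_sphere_net d (s := 1 / √m) (by positivity)
    (by rw [div_le_one (by positivity)]; exact hsq)
  -- Chosen so that exp(-m s₁ τ) times the net size (3√m)^d is at most exp(-t).
  set τ := (d * Real.log (3 * √m) + t) / (m * s₁) with hτ
  have hdm' : (d : ℝ) ≤ m := by
    have : d ≤ d ^ 3 := Nat.le_self_pow (by norm_num) d
    exact_mod_cast this.trans hdm.le
  have hsub : {S : Fin m → E d × ℝ | ¬ ∀ θ ∈ Theta d, empRamp S θ ≤ empRamp S (r⁻¹ • μ) →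
          r - inner ℝ θ μ ≤ ((7 / s₁ + √(C₁ * 3)) / κ + r) * √((1 + t) / m)}
      ⊆ {S | ¬ ∀ u ∈ Theta d, (1 / m : ℝ) * ∑ i, margin u (S i) ^ 2 ≤ C₁ * (1 + (d + t) / m)}
        ∪ ⋃ y ∈ T, {S | (1 / m : ℝ) * ∑ i, (ramp (margin y (S i)) - ramp (margin (r⁻¹ • μ) (S i)))
          < κ * (r - inner ℝ y μ) - τ} := by
    intro S hS
    by_contra hcon
    simp only [Set.mem_union, Set.mem_iUnion, Set.mem_ofPred_eq, not_or, not_not, not_exists,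
      not_lt] at hcon
    apply hS
    intro θ hθ hle
    have hQ : ∀ u ∈ Theta d, (1 / m : ℝ) * ∑ i, margin u (S i) ^ 2 ≤ C₁ * 3 := by
      intro u hu
      refine (hcon.1 u hu).trans ?_
      have : (d + t) / m ≤ 2 := by rw [div_le_iff₀ hm0]; linarith
      gcongr; linarith
    refine (sub_inner_le_of_net S hμ hκ hQ hnet hcon.2 hθ hle).trans ?_
    set v := √((1 + t) / m) with hv
    have hv1 : 1 / √(m : ℝ) ≤ v := by
      rw [hv, Real.sqrt_div (by positivity)]
      gcongr
      exact Real.one_le_sqrt.2 (by linarith)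
    have hv2 : t / m ≤ v := by
      apply Real.le_sqrt_of_sq_le
      have h1 : t / m ≤ 1 := by rw [div_le_one hm0]; exact htm
      have h2 : t / m ≤ (1 + t) / m := by gcongr; linarith
      have h3 : 0 ≤ t / m := by positivity
      nlinarith
    have hτv : τ ≤ 7 / s₁ * v := by
      have h1 := mul_log_le_sqrt hm hdm
      calc τ ≤ (6 * √m + t) / (m * s₁) := by rw [hτ]; gcongr
        _ = (6 * (1 / √m) + t / m) / s₁ := by
            have : 1 / √(m : ℝ) = √m / m := by rw [div_eq_div_iff (by positivity) hm0.ne']; linarith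
            rw [this]; field_simp
        _ ≤ (6 * v + v) / s₁ := by gcongr
        _ = 7 / s₁ * v := by ring
    calc (τ + 1 / √m * √(C₁ * 3)) / κ + 1 / √m * r
        ≤ (7 / s₁ * v + v * √(C₁ * 3)) / κ + v * r := by gcongr
      _ = ((7 / s₁ + √(C₁ * 3)) / κ + r) * v := by ring
  refine (measure_mono hsub).trans ((measure_union_le _ _).trans ?_)
  rw [two_mul, ENNReal.ofReal_add (Real.exp_pos _).le (Real.exp_pos _).le]
  refine add_le_add (hmom d m μ t hμ hd hm ht) ?_
  refine (measure_biUnion_finset_le _ _).trans ((Finset.sum_le_sum fun y hy =>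
    hdev d m μ y τ hμ (hT y hy) hm).trans ?_)
  rw [Finset.sum_const, nsmul_eq_mul, ← ENNReal.ofReal_natCast,
    ← ENNReal.ofReal_mul (by positivity)]
  apply ENNReal.ofReal_le_ofReal
  have h1 : (m : ℝ) * s₁ * τ = d * Real.log (3 * √m) + t := by rw [hτ]; field_simp
  have h2 : (3 / (1 / √(m : ℝ))) ^ d = Real.exp (d * Real.log (3 * √m)) := by
    rw [Real.exp_nat_mul, Real.exp_log (by positivity)]; congr 1; field_simp
  calc (T.card : ℝ) * Real.exp (-(m * s₁ * τ))
      ≤ Real.exp (d * Real.log (3 * √m)) * Real.exp (-(m * s₁ * τ)) := by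
        gcongr; exact hcard.trans_eq h2
    _ = Real.exp (-t) := by rw [← Real.exp_add, h1]; ring_nf

instance isProbabilityMeasure_sampleLaw {d : ℕ} (m n : ℕ) (μ₀ : E d) (σ₀ : ℝ) (μ₁ : E d)
    (σ₁ : ℝ) : IsProbabilityMeasure (sampleLaw m n μ₀ σ₀ μ₁ σ₁) := by
  unfold sampleLaw; infer_instance

theorem sampleLaw_fst {d : ℕ} (m n : ℕ) (μ₀ : E d) (σ₀ : ℝ) (μ₁ : E d) (σ₁ : ℝ)
    (A : Set (Fin m → E d × ℝ)) :
    sampleLaw m n μ₀ σ₀ μ₁ σ₁ {S | S.1 ∈ A} = (Measure.pi fun _ => labeledLaw μ₀ σ₀) A := by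
  have : {S : Samples d m n | S.1 ∈ A} = A ×ˢ Set.univ := by ext; simp
  rw [sampleLaw, this, Measure.prod_prod, measure_univ, mul_one]

theorem sampleLaw_snd {d : ℕ} (m n : ℕ) (μ₀ : E d) (σ₀ : ℝ) (μ₁ : E d) (σ₁ : ℝ)
    (A : Set (Fin n → E d)) :
    sampleLaw m n μ₀ σ₀ μ₁ σ₁ {S | S.2 ∈ A} = (Measure.pi fun _ => unlabeledLaw μ₁ σ₁) A := by
  have : {S : Samples d m n | S.2 ∈ A} = Set.univ ×ˢ A := by ext; simp
  rw [sampleLaw, this, Measure.prod_prod, measure_univ, one_mul]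

/-- In high dimension, RSS training finds the Bayes classifier up to the error of the principal
direction of the unlabeled data. -/
theorem exists_high_dimension_bound {r σ b : ℝ} (hr : 0 < r) (hσ : 0 < σ) (hb : 0 ≤ b) :
    ∃ C c s : ℝ, 0 < C ∧ 0 < c ∧ 0 < s ∧
      ∀ (d m n : ℕ) (μ₀ μ₁ : E d) (σ₁ β t x δ : ℝ), ‖μ₀‖ = r → 1 ≤ d → 1 ≤ m → 1 ≤ n →
        m ≤ d ^ 3 → 0 ≤ t → t ≤ s * m → ‖μ₀ - μ₁‖ ≤ β → |σ₁ - σ| ≤ β → β ≤ b →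
        0 ≤ x → x ≤ 1 → n * x ^ 2 = d + t → (x + 1 / n + β) * (1 + (d + t) / m) ≤ c →
        sampleLaw m n μ₀ σ μ₁ σ₁
          {S | ¬ ((∀ i, (S.1 i).2 = 1 ∨ (S.1 i).2 = -1) →
            ∀ θ, IsRSSEstimator (paramRule d m n δ S) S θ →
              r - inner ℝ θ μ₀ ≤ C * (x + 1 / n + β))}
          ≤ ENNReal.ofReal (3 * Real.exp (-t)) := by
  obtain ⟨C₁, hC₁, hmom⟩ := exists_margin_moment_bound hr hσ
  obtain ⟨κ, s₁, hκ, hs₁, hdev⟩ := exists_ramp_excess_deviation hr hσ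
  obtain ⟨C₂, hC₂, hmom₂⟩ := exists_uniform_moment_deviation (M := r + σ + b + 1) (by linarith)
  set G := 4 * C₂ + 1 + 2 * (2 * r + b) with hG
  have hG0 : 0 < G := by positivity
  -- The 16 leaves a factor 2 for the strict smallness condition 8ηQ < κ²r⁴. The third constant
  -- makes the failure probability of the sign test at most exp(-t).
  refine ⟨G / r, κ ^ 2 * r ^ 4 / (16 * G * C₁), s₁ * (κ * r), by positivity, by positivity,
    by positivity, ?_⟩
  intro d m n μ₀ μ₁ σ₁ β t x δ hμ hd hm hn hmd ht hts hβ hσβ hβb hx hx1 hnx hsmall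
  have hm0 : (0 : ℝ) < m := by exact_mod_cast hm
  have hn0 : (0 : ℝ) < n := by exact_mod_cast hn
  have hβ0 : 0 ≤ β := (norm_nonneg _).trans hβ
  set ρ : ℝ := (d + t) / m with hρ
  have hρ0 : 0 ≤ ρ := by positivity
  set h := x + 1 / n + β with hh
  have hh0 : 0 ≤ h := by positivity
  set A₁ : Set (Fin m → E d × ℝ) :=
    {S | ¬ ∀ u ∈ Theta d, (1 / m : ℝ) * ∑ i, margin u (S i) ^ 2 ≤ C₁ * (1 + ρ)} with hA₁
  set A₂ : Set (Fin m → E d × ℝ) :=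
    {S | (1 / m : ℝ) * ∑ i, (ramp (margin (-(r⁻¹ • μ₀)) (S i))
      - ramp (margin (r⁻¹ • μ₀) (S i))) < κ * (r - inner ℝ (-(r⁻¹ • μ₀)) μ₀) - κ * r} with hA₂
  set A₃ : Set (Fin n → E d) :=
    {X | ¬ ∀ u ∈ Theta d, |(1 / n : ℝ) * ∑ j, inner ℝ u (X j) ^ 2
      - (inner ℝ u μ₁ ^ 2 + σ₁ ^ 2)| ≤ C₂ * (x + x ^ 2)} with hA₃
  have hsub : {S : Samples d m n | ¬ ((∀ i, (S.1 i).2 = 1 ∨ (S.1 i).2 = -1) →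
            ∀ θ, IsRSSEstimator (paramRule d m n δ S) S θ → r - inner ℝ θ μ₀ ≤ G / r * h)}
      ⊆ {S | S.1 ∈ A₁} ∪ ({S | S.1 ∈ A₂} ∪ {S | S.2 ∈ A₃}) := by
    intro S hS
    by_contra hcon
    simp only [Set.mem_union, Set.mem_ofPred_eq, not_or, hA₁, hA₂, hA₃, not_not, not_lt] at hcon
    obtain ⟨hc1, hc2, hc3⟩ := hcon
    apply hS
    intro hlab θ hθ
    have hηle : 2 * (2 * C₂ * x) + 1 / n + 2 * (β * (2 * r + β)) ≤ G * h := by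
      have h1 : β * (2 * r + β) ≤ β * (2 * r + b) := by gcongr
      have h2 : G * h = 4 * C₂ * x + 1 / n + 2 * (β * (2 * r + b))
          + (1 + 2 * (2 * r + b)) * x + (4 * C₂ + 2 * (2 * r + b)) * (1 / n)
          + (4 * C₂ + 1) * β := by rw [hG, hh]; ring
      have h3 : 0 ≤ (1 + 2 * (2 * r + b)) * x + (4 * C₂ + 2 * (2 * r + b)) * (1 / n)
          + (4 * C₂ + 1) * β := by positivity
      linarith
    have hsm : 8 * (2 * (2 * C₂ * x) + 1 / n + 2 * (β * (2 * r + β))) * (C₁ * (1 + ρ))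
        < κ ^ 2 * r ^ 4 := by
      calc 8 * (2 * (2 * C₂ * x) + 1 / n + 2 * (β * (2 * r + β))) * (C₁ * (1 + ρ))
          ≤ 8 * (G * h) * (C₁ * (1 + ρ)) := by gcongr
        _ = 8 * G * C₁ * (h * (1 + ρ)) := by ring
        _ ≤ 8 * G * C₁ * (κ ^ 2 * r ^ 4 / (16 * G * C₁)) := by gcongr
        _ = κ ^ 2 * r ^ 4 / 2 := by field_simp; norm_num
        _ < κ ^ 2 * r ^ 4 := half_lt_self (by positivity)
    have hfin := sub_inner_le_of_moments S hlab hmd hn (e := 2 * C₂ * x) hr hμ hκ hc1 (by positivity)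
      hc2 (fun u hu => (hc3 u hu).trans (by
        nlinarith [mul_nonneg hC₂.le (mul_nonneg hx (sub_nonneg.2 hx1))])) hβ rfl hsm hθ
    refine hfin.trans ?_
    rw [div_mul_eq_mul_div]
    gcongr
  refine (measure_mono hsub).trans ((measure_union_le _ _).trans
    ((add_le_add le_rfl (measure_union_le _ _)).trans ?_))
  rw [sampleLaw_fst, sampleLaw_fst, sampleLaw_snd]
  have hb1 := hmom d m μ₀ t hμ hd hm ht
  -- The ramp loss is tested in the single direction -θ₀, so no net is needed and this tail is free
  -- of d.
  have hb2 := hdev d m μ₀ (-(r⁻¹ • μ₀)) (κ * r) hμ (by simpa using inv_smul_mem_Theta hr hμ) hm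
  have hb3 := hmom₂ (unlabeledLaw μ₁ σ₁) d n id μ₁ σ₁ t x measurable_id
    (by
      have := norm_sub_norm_le μ₁ μ₀
      rw [norm_sub_rev] at this
      linarith)
    (by
      have := abs_add_le σ (σ₁ - σ)
      rw [add_sub_cancel, abs_of_pos hσ] at this
      linarith)
    (fun θ hθ => map_sq_inner_unlabeledLaw_of_mem_Theta μ₁ σ₁ hθ) hd hn ht hx hnx
  have hb2' : ENNReal.ofReal (Real.exp (-(m * s₁ * (κ * r)))) ≤ ENNReal.ofReal (Real.exp (-t)) := by
    gcongr
    linarith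
  refine (add_le_add hb1 (add_le_add (hb2.trans hb2') hb3)).trans (le_of_eq ?_)
  rw [← ENNReal.ofReal_add (by positivity) (by positivity),
    ← ENNReal.ofReal_add (by positivity) (by positivity)]
  congr 1; ring

/-! ### From mean-margin events to excess risk bounds. -/

theorem sampleLaw_label {d : ℕ} (m n : ℕ) (μ₀ : E d) (σ₀ : ℝ) (μ₁ : E d) (σ₁ : ℝ) :
    sampleLaw m n μ₀ σ₀ μ₁ σ₁ {S | ¬ ∀ i, (S.1 i).2 = 1 ∨ (S.1 i).2 = -1} = 0 := by
  have h1 := sampleLaw_fst m n μ₀ σ₀ μ₁ σ₁ {S | ¬ ∀ i, (S i).2 = 1 ∨ (S i).2 = -1}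
  refine h1.trans ?_
  change ∀ᵐ S ∂(Measure.pi fun _ : Fin m => labeledLaw μ₀ σ₀), ∀ i, (S i).2 = 1 ∨ (S i).2 = -1
  exact ae_all_iff.2 fun i => (Measure.tendsto_eval_ae_ae
    (μ := fun _ : Fin m => labeledLaw μ₀ σ₀) (i := i)).eventually (ae_labeledLaw_label μ₀ σ₀)

/-- Minimizers exist whenever all labels are ±1, which is almost sure, so only the mean margin has
to be controlled. -/
theorem excessRiskBound_of_measure_le {d m n : ℕ} {μ₀ μ₁ : E d} {σ₀ σ₁ δ b ρ r : ℝ} (hd : 1 ≤ d)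
    (hσ : 0 < σ₀) (hμ : ‖μ₀‖ = r) (hρ : ρ / σ₀ ≤ b)
    (h : sampleLaw m n μ₀ σ₀ μ₁ σ₁
      {S | ¬ ((∀ i, (S.1 i).2 = 1 ∨ (S.1 i).2 = -1) →
        ∀ θ, IsRSSEstimator (paramRule d m n δ S) S θ → r - inner ℝ θ μ₀ ≤ ρ)}
      ≤ ENNReal.ofReal δ) :
    ExcessRiskBound paramRule m n μ₀ σ₀ μ₁ σ₁ δ b := by
  unfold ExcessRiskBound
  have hsub : {S : Samples d m n | ¬ ((∃ θ, IsRSSEstimator (paramRule d m n δ S) S θ) ∧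
      ∀ θ, IsRSSEstimator (paramRule d m n δ S) S θ → excessRisk (labeledLaw μ₀ σ₀) θ ≤ b)}
      ⊆ {S | ¬ ∀ i, (S.1 i).2 = 1 ∨ (S.1 i).2 = -1} ∪
        {S | ¬ ((∀ i, (S.1 i).2 = 1 ∨ (S.1 i).2 = -1) →
          ∀ θ, IsRSSEstimator (paramRule d m n δ S) S θ → r - inner ℝ θ μ₀ ≤ ρ)} := by
    intro S hS
    by_contra hcon
    simp only [Set.mem_union, Set.mem_ofPred_eq, not_or, not_not] at hcon
    refine hS ⟨exists_isRSSEstimator hd S hcon.1, fun θ hθ => ?_⟩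
    refine (excessRisk_le hσ hμ hθ.1).trans (le_trans ?_ hρ)
    gcongr
    exact hcon.2 hcon.1 θ hθ
  refine (measure_mono hsub).trans ((measure_union_le _ _).trans ?_)
  rw [sampleLaw_label, zero_add]
  exact h

theorem excessRiskBound_of_one_le {d m n : ℕ} {μ₀ μ₁ : E d} {σ₀ σ₁ δ b : ℝ} (hd : 1 ≤ d)
    (hb : 1 ≤ b) : ExcessRiskBound paramRule m n μ₀ σ₀ μ₁ σ₁ δ b := by
  unfold ExcessRiskBound
  refine le_trans (measure_mono ?_)
    ((sampleLaw_label m n μ₀ σ₀ μ₁ σ₁).le.trans zero_le)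
  intro S hS hcon
  exact hS ⟨exists_isRSSEstimator hd S hcon, fun θ hθ =>
    (excessRisk_le_one μ₀ σ₀ hθ.1).trans hb⟩

/-- For μ₀ = 0 all classifiers have the same risk. This case is separate because the direction r⁻¹ •
μ₀ degenerates. -/
theorem excessRiskBound_of_norm_eq_zero {d m n : ℕ} {μ₀ μ₁ : E d} {σ₀ σ₁ δ b : ℝ} (hd : 1 ≤ d)
    (hσ : 0 < σ₀) (hμ : ‖μ₀‖ = 0) (hb : 0 ≤ b) :
    ExcessRiskBound paramRule m n μ₀ σ₀ μ₁ σ₁ δ b := by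
  refine excessRiskBound_of_measure_le (ρ := 0) hd hσ hμ (by simpa) ?_
  have h0 : μ₀ = 0 := norm_eq_zero.1 hμ
  simp [h0]

theorem excessRiskBound_low_dimension {r σ : ℝ} (hr : 0 < r) (hσ : 0 < σ) :
    ∃ C : ℝ, 0 < C ∧ ∀ (d m n : ℕ) (μ₀ μ₁ : E d) (σ₁ t δ b : ℝ), ‖μ₀‖ = r → 1 ≤ d → 1 ≤ m →
      d ^ 3 < m → 0 ≤ t → t ≤ m → 3 * Real.exp (-t) = δ → C * √((1 + t) / m) ≤ b →
      ExcessRiskBound paramRule m n μ₀ σ μ₁ σ₁ δ b := by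
  obtain ⟨C, hC, hlow⟩ := exists_low_dimension_bound hr hσ
  refine ⟨C / σ, by positivity, ?_⟩
  intro d m n μ₀ μ₁ σ₁ t δ b hμ hd hm hdm ht htm hδ hb
  refine excessRiskBound_of_measure_le (ρ := C * √((1 + t) / m)) hd hσ hμ
    (by rwa [div_mul_eq_mul_div] at hb) ?_
  have h1 := hlow d m μ₀ t hμ hd hm hdm ht htm
  rw [← sampleLaw_fst m n μ₀ σ μ₁ σ₁] at h1
  refine (measure_mono ?_).trans (h1.trans ?_)
  · intro S hS hcon
    refine hS fun hlab θ hθ => ?_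
    have h2 := hθ.2 _ (inv_smul_mem_Theta hr hμ)
    rw [objective_paramRule_of_lt S hlab hdm hθ.1,
      objective_paramRule_of_lt S hlab hdm (inv_smul_mem_Theta hr hμ)] at h2
    exact hcon θ hθ.1 h2
  · rw [← hδ]
    gcongr
    norm_num

theorem excessRiskBound_high_dimension {r σ b : ℝ} (hr : 0 < r) (hσ : 0 < σ) (hb : 0 ≤ b) :
    ∃ C c s : ℝ, 0 < C ∧ 0 < c ∧ 0 < s ∧
      ∀ (d m n : ℕ) (μ₀ μ₁ : E d) (σ₁ β t x δ B : ℝ), ‖μ₀‖ = r → 1 ≤ d → 1 ≤ m → 1 ≤ n →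
        m ≤ d ^ 3 → 0 ≤ t → t ≤ s * m → ‖μ₀ - μ₁‖ ≤ β → |σ₁ - σ| ≤ β → β ≤ b →
        x = √((d + t) / n) → x ≤ 1 → (x + 1 / n + β) * (1 + (d + t) / m) ≤ c →
        3 * Real.exp (-t) = δ → C * (x + 1 / n + β) ≤ B →
        ExcessRiskBound paramRule m n μ₀ σ μ₁ σ₁ δ B := by
  obtain ⟨C, c, s, hC, hc, hs, hhigh⟩ := exists_high_dimension_bound hr hσ hb
  refine ⟨C / σ, c, s, by positivity, hc, hs, ?_⟩
  intro d m n μ₀ μ₁ σ₁ β t x δ B hμ hd hm hn hmd ht hts hβ hσβ hβb hx hx1 hsmall hδ hB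
  have hn0 : (0 : ℝ) < n := by exact_mod_cast hn
  refine excessRiskBound_of_measure_le (ρ := C * (x + 1 / n + β)) hd hσ hμ
    (by rwa [div_mul_eq_mul_div] at hB) ?_
  rw [← hδ]
  refine hhigh d m n μ₀ μ₁ σ₁ β t x _ hμ hd hm hn hmd ht hts hβ hσβ hβb
    (by rw [hx]; positivity) hx1 ?_ hsmall
  rw [hx, Real.sq_sqrt (by positivity)]
  field_simp

/-- The value of t that turns a union bound over three events into δ. -/
theorem three_mul_exp_neg_log {δ : ℝ} (hδ : 0 < δ) :
    3 * Real.exp (-(Real.log (1 / δ) + Real.log 3)) = δ := by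
  rw [neg_add, Real.exp_add, Real.log_div one_ne_zero hδ.ne', Real.log_one, zero_sub, neg_neg,
    Real.exp_log hδ, Real.exp_neg, Real.exp_log (by norm_num)]
  field_simp

theorem log_three_mem : 0 ≤ Real.log 3 ∧ Real.log 3 ≤ 2 :=
  ⟨Real.log_nonneg (by norm_num), (Real.log_le_sub_one_of_pos (by norm_num)).trans (by norm_num)⟩

/-! ### Choice of constants for the two claims. -/

set_option maxHeartbeats 1000000 in
/-- The dimension-dependent part of the bound is `c √(d / m)` for any `c`, if there are enough
unlabeled data and the shift is small. -/
theorem exists_excessRiskBound_sqrt {r σ₀ K : ℝ} (hr : 0 < r) (hσ : 0 < σ₀) (hK : 0 < K) :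
    ∃ C : ℝ, 0 < C ∧ ∀ c : ℝ, 0 < c → ∃ c₁ c₂ : ℝ, 0 < c₁ ∧ 0 < c₂ ∧
      ∀ (d m n : ℕ) (μ₀ μ₁ : E d) (σ₁ α δ : ℝ), 1 ≤ d → 1 ≤ m →
        ‖μ₀‖ = r → 0 ≤ α → ‖μ₀ - μ₁‖ ≤ K * α → |σ₁ - σ₀| ≤ K * α →
        0 < δ → δ < 1 → α ≤ c₁ * ((d : ℝ) / m) → c₂ * ((m : ℝ) ^ 2 / d) ≤ n →
        ExcessRiskBound paramRule m n μ₀ σ₀ μ₁ σ₁ δ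
          (c * √((d : ℝ) / m) + C * √((1 + Real.log (1 / δ)) / m)) := by
  obtain ⟨CE, hCE, hlow⟩ := excessRiskBound_low_dimension hr hσ
  obtain ⟨CP, cP, sP, hCP, hcP, hsP, hhigh⟩ :=
    excessRiskBound_high_dimension (b := 1) hr hσ zero_le_one
  set p := min 1 sP with hp
  have hp0 : 0 < p := by positivity
  have hp1 : p ≤ 1 := min_le_left _ _
  have hps : p ≤ sP := min_le_right _ _
  -- Fixed before c: 2/p covers the case where m is too small for δ and the bound exceeds 1, and 2CE
  -- covers the regime d³ < m.
  refine ⟨2 / p + 2 * CE, by positivity, fun c hc => ?_⟩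
  set ω := min (min c (c / (3 * CP))) (cP / (3 * (1 / c) * (2 + (1 / c) ^ 2))) with hω
  have hω0 : 0 < ω := by positivity
  have hω1 : ω ≤ c := (min_le_left _ _).trans (min_le_left _ _)
  have hω2 : CP * (3 * ω) ≤ c := by
    have : ω ≤ c / (3 * CP) := (min_le_left _ _).trans (min_le_right _ _)
    rw [le_div_iff₀ (by positivity)] at this
    linarith
  have hω3 : 3 * ω * (1 / c) * (2 + (1 / c) ^ 2) ≤ cP := by
    have : ω ≤ cP / (3 * (1 / c) * (2 + (1 / c) ^ 2)) := min_le_right _ _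
    rw [le_div_iff₀ (by positivity)] at this
    linarith
  -- Each of the three error terms is to be at most ωv with v = √(d/m). The first witness handles
  -- Kα, and the two summands of the second handle √((d + t)/n) and 1/n.
  refine ⟨ω * c / K, (1 + (1 / c) ^ 2) / ω ^ 2 + (1 / c) / ω, by positivity, by positivity, ?_⟩
  intro d m n μ₀ μ₁ σ₁ α δ hd hm hμ hα hβ hσβ hδ hδ1 hαd hn
  have hm0 : (0 : ℝ) < m := by exact_mod_cast hm
  have hm1 : (1 : ℝ) ≤ m := by exact_mod_cast hm
  have hd0 : (0 : ℝ) < d := by exact_mod_cast hd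
  set l := Real.log (1 / δ) with hl
  have hl0 : 0 ≤ l := Real.log_nonneg (by rw [le_div_iff₀ hδ]; linarith)
  set w := √((1 + l) / m) with hw
  have hw0 : 0 ≤ w := Real.sqrt_nonneg _
  set v := √((d : ℝ) / m) with hv
  have hv0 : 0 ≤ v := Real.sqrt_nonneg _
  have hv2 : v ^ 2 = d / m := Real.sq_sqrt (by positivity)
  have hCw : 2 / p * w ≤ (2 / p + 2 * CE) * w := by gcongr; linarith
  have hCw' : 2 * CE * w ≤ (2 / p + 2 * CE) * w := by
    gcongr; linarith [show 0 ≤ 2 / p by positivity]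
  have hcv : 0 ≤ c * v := by positivity
  by_cases htriv : 2 * (1 + l) ≤ p * m
  swap
  · apply excessRiskBound_of_one_le hd
    have h1 : p / 2 ≤ w := by
      apply Real.le_sqrt_of_sq_le
      rw [le_div_iff₀ hm0]
      nlinarith
    have h2 : 1 ≤ 2 / p * w := by
      calc (1 : ℝ) = 2 / p * (p / 2) := by field_simp
        _ ≤ 2 / p * w := by gcongr
    linarith
  -- Otherwise the bound exceeds 1. The remaining case has d/m ≤ 1/c², which keeps the moment factor
  -- 1 + (d + t)/m bounded.
  by_cases hv1 : c * v ≤ 1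
  swap
  · apply excessRiskBound_of_one_le hd
    linarith [mul_nonneg (show 0 ≤ 2 / p + 2 * CE by positivity) hw0]
  set t := l + Real.log 3 with ht
  obtain ⟨hlog0, hlog2⟩ := log_three_mem
  have ht0 : 0 ≤ t := by positivity
  have htp : t ≤ p * m := by linarith
  have htm : t ≤ m := by nlinarith
  have hδt : 3 * Real.exp (-t) = δ := three_mul_exp_neg_log hδ
  rcases lt_or_ge (d ^ 3) m with hdm | hdm
  · refine hlow d m n μ₀ μ₁ σ₁ t δ _ hμ hd hm hdm ht0 htm hδt ?_
    have h1 : √((1 + t) / m) ≤ 2 * w := by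
      rw [hw, Real.sqrt_le_left (by positivity), mul_pow, Real.sq_sqrt (by positivity),
        ← mul_div_assoc]
      gcongr
      linarith
    calc CE * √((1 + t) / m) ≤ CE * (2 * w) := by gcongr
      _ = 2 * CE * w := by ring
      _ ≤ _ := by linarith
  · have hvc : v ≤ 1 / c := by rw [le_div_iff₀ hc]; linarith
    have hnpos : (0 : ℝ) < n := lt_of_lt_of_le (by positivity) hn
    have hn1 : 1 ≤ n := by
      have : 0 < n := by exact_mod_cast hnpos
      omega
    have hnd : ∀ e : ℝ, 0 ≤ e → e ≤ (1 + (1 / c) ^ 2) / ω ^ 2 + (1 / c) / ω →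
        e * m ≤ n * v ^ 2 := by
      intro e _ he
      have h1 : e * ((m : ℝ) ^ 2 / d) ≤ n := le_trans (by gcongr) hn
      rw [hv2]
      calc e * m = e * ((m : ℝ) ^ 2 / d) * (d / m) := by field_simp
        _ ≤ n * (d / m) := by gcongr
    have hx : √((d + t) / n) ≤ ω * v := by
      rw [Real.sqrt_le_left (by positivity), div_le_iff₀ hnpos]
      have h1 := hnd ((1 + (1 / c) ^ 2) / ω ^ 2) (by positivity)
        (le_add_of_nonneg_right (by positivity))
      have h2 : (d : ℝ) ≤ (1 / c) ^ 2 * m := by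
        have : v ^ 2 ≤ (1 / c) ^ 2 := by gcongr
        rwa [hv2, div_le_iff₀ hm0] at this
      calc d + t ≤ (1 + (1 / c) ^ 2) * m := by linarith
        _ = ω ^ 2 * ((1 + (1 / c) ^ 2) / ω ^ 2 * m) := by field_simp
        _ ≤ ω ^ 2 * (n * v ^ 2) := by gcongr
        _ = (ω * v) ^ 2 * n := by ring
    have hninv : 1 / (n : ℝ) ≤ ω * v := by
      have h1 := hnd ((1 / c) / ω) (by positivity) (le_add_of_nonneg_left (by positivity))
      rw [div_le_iff₀ hnpos]
      have h2 : (1 / c) / ω ≤ (1 / c) / ω * m := le_mul_of_one_le_right (by positivity) hm1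
      have h3 : n * v ^ 2 ≤ n * (v * (1 / c)) := by rw [sq]; gcongr
      have h4 : (1 / c) / ω ≤ n * (v * (1 / c)) := h2.trans (h1.trans h3)
      calc (1 : ℝ) = ω * c * ((1 / c) / ω) := by field_simp
        _ ≤ ω * c * (n * (v * (1 / c))) := by gcongr
        _ = ω * v * n := by field_simp
    have hKα : K * α ≤ ω * v := by
      calc K * α ≤ K * (ω * c / K * (d / m)) := by gcongr
        _ = ω * c * v ^ 2 := by rw [hv2]; field_simp
        _ = ω * v * (c * v) := by ring
        _ ≤ ω * v := mul_le_of_le_one_right (by positivity) hv1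
    have hωv : ω * v ≤ 1 := le_trans (by gcongr) hv1
    have hsum : √((d + t) / n) + 1 / n + K * α ≤ 3 * ω * v := by linarith
    refine hhigh d m n μ₀ μ₁ σ₁ (K * α) t _ δ _ hμ hd hm hn1 hdm ht0
      (htp.trans (by gcongr)) hβ hσβ (hKα.trans hωv) rfl (hx.trans hωv) ?_ hδt ?_
    · have h1 : (d + t) / m ≤ (1 / c) ^ 2 + 1 := by
        rw [add_div, ← hv2]
        have h2 : t / m ≤ 1 := by rw [div_le_one hm0]; exact htm
        have h3 : v ^ 2 ≤ (1 / c) ^ 2 := by gcongr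
        linarith
      calc (√((d + t) / n) + 1 / n + K * α) * (1 + (d + t) / m)
          ≤ (3 * ω * (1 / c)) * (2 + (1 / c) ^ 2) := by
            apply mul_le_mul _ (by linarith) (by positivity) (by positivity)
            exact hsum.trans (by gcongr)
        _ ≤ cP := hω3
    · calc CP * (√((d + t) / n) + 1 / n + K * α) ≤ CP * (3 * ω * v) := by gcongr
        _ = CP * (3 * ω) * v := by ring
        _ ≤ c * v := by gcongr
        _ ≤ _ := le_add_of_nonneg_right (by positivity)

set_option maxHeartbeats 1000000 in
/-- The number of labeled points that suffices for excess risk `ε` does not depend on the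
dimension. -/
theorem exists_excessRiskBound_dimension_free {r σ₀ K A B : ℝ} (hr : 0 < r) (hσ : 0 < σ₀)
    (hK : 0 < K) (hA : 0 < A) (hB : 0 < B) :
    ∃ C : ℝ, 0 < C ∧ ∀ ε δ : ℝ, 0 < ε → 0 < δ → δ < 1 →
      ∀ (d m n : ℕ) (μ₀ μ₁ : E d) (σ₁ α : ℝ), 1 ≤ d → 1 ≤ m →
        ‖μ₀‖ = r → 0 ≤ α → ‖μ₀ - μ₁‖ ≤ K * α → |σ₁ - σ₀| ≤ K * α →
        α ≤ A / d → B * (d : ℝ) ^ 3 ≤ n →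
        C * max (1 / ε ^ 4) (Real.log (1 / δ) / ε ^ 2) ≤ m →
        ExcessRiskBound paramRule m n μ₀ σ₀ μ₁ σ₁ δ ε := by
  obtain ⟨CE, hCE, hlow⟩ := excessRiskBound_low_dimension hr hσ
  obtain ⟨CP, cP, sP, hCP, hcP, hsP, hhigh⟩ :=
    excessRiskBound_high_dimension (b := K * A) hr hσ (by positivity)
  set p := min 1 sP with hp
  have hp0 : 0 < p := by positivity
  have hp1 : p ≤ 1 := min_le_left _ _
  have hps : p ≤ sP := min_le_right _ _
  set G := √(2 / B) + 1 / B + K * A with hG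
  have hG0 : 0 < G := by positivity
  set ω := min (min (1 / CE) p) (min (1 / (CP * G)) (min (1 / G) (cP / (3 * G)))) with hω
  have hω0 : 0 < ω := by positivity
  have hω1 : CE * ω ≤ 1 := by
    have : ω ≤ 1 / CE := (min_le_left _ _).trans (min_le_left _ _)
    rw [le_div_iff₀ hCE] at this; linarith
  have hω2 : ω ≤ p := (min_le_left _ _).trans (min_le_right _ _)
  have hω3 : CP * (ω * G) ≤ 1 := by
    have : ω ≤ 1 / (CP * G) := (min_le_right _ _).trans (min_le_left _ _)
    rw [le_div_iff₀ (by positivity)] at this; linarith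
  have hω4 : ω * G ≤ 1 := by
    have : ω ≤ 1 / G := (min_le_right _ _).trans ((min_le_right _ _).trans (min_le_left _ _))
    rwa [le_div_iff₀ hG0] at this
  have hω5 : 3 * (ω * G) ≤ cP := by
    have : ω ≤ cP / (3 * G) := (min_le_right _ _).trans ((min_le_right _ _).trans (min_le_right _ _))
    rw [le_div_iff₀ (by positivity)] at this; linarith
  have hω6 : ω ≤ 1 := hω2.trans hp1
  -- The cube matches m ≤ d³ and will give d(ωε) ≥ 1. The 4 covers 1 + t ≤ 3 + log(1/δ), three
  -- quarters from the ε⁻⁴ condition and one quarter from the other.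
  refine ⟨4 / ω ^ 3, by positivity, ?_⟩
  intro ε δ hε hδ hδ1 d m n μ₀ μ₁ σ₁ α hd hm hμ hα hβ hσβ hαd hn hmC
  have hm0 : (0 : ℝ) < m := by exact_mod_cast hm
  have hm1 : (1 : ℝ) ≤ m := by exact_mod_cast hm
  have hd0 : (0 : ℝ) < d := by exact_mod_cast hd
  have hd1 : (1 : ℝ) ≤ d := by exact_mod_cast hd
  rcases le_or_gt 1 ε with hε1 | hε1
  · exact excessRiskBound_of_one_le hd hε1
  set l := Real.log (1 / δ) with hl
  have hl0 : 0 ≤ l := Real.log_nonneg (by rw [le_div_iff₀ hδ]; linarith)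
  have hm4 : 4 / ω ^ 3 * (1 / ε ^ 4) ≤ m :=
    le_trans (by gcongr; exact le_max_left _ _) hmC
  have hml : 4 / ω ^ 3 * (l / ε ^ 2) ≤ m :=
    le_trans (by gcongr; exact le_max_right _ _) hmC
  have hm4' : 4 ≤ m * ω ^ 3 * ε ^ 4 := by
    rw [div_mul_div_comm, div_le_iff₀ (by positivity)] at hm4; linarith
  have hml' : 4 * l ≤ m * ω ^ 3 * ε ^ 2 := by
    rw [div_mul_div_comm, div_le_iff₀ (by positivity)] at hml; linarith
  set t := l + Real.log 3 with ht
  obtain ⟨hlog0, hlog2⟩ := log_three_mem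
  have ht0 : 0 ≤ t := by positivity
  have hδt : 3 * Real.exp (-t) = δ := three_mul_exp_neg_log hδ
  have hε2 : ε ^ 2 ≤ 1 := pow_le_one₀ hε.le hε1.le
  have hω2' : ω ^ 2 ≤ 1 := pow_le_one₀ hω0.le hω6
  have h1t : 1 + t ≤ m * (ω * ε) ^ 2 := by
    have h1 : m * ω ^ 3 * ε ^ 4 ≤ m * (ω * ε) ^ 2 := by
      calc m * ω ^ 3 * ε ^ 4 = m * (ω * ε) ^ 2 * (ω * ε ^ 2) := by ring
        _ ≤ m * (ω * ε) ^ 2 := mul_le_of_le_one_right (by positivity)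
            (mul_le_one₀ hω6 (by positivity) hε2)
    have h2 : m * ω ^ 3 * ε ^ 2 ≤ m * (ω * ε) ^ 2 := by
      calc m * ω ^ 3 * ε ^ 2 = m * (ω * ε) ^ 2 * ω := by ring
        _ ≤ m * (ω * ε) ^ 2 := mul_le_of_le_one_right (by positivity) hω6
    linarith
  have hωε : ω * ε ≤ ω := mul_le_of_le_one_right hω0.le hε1.le
  have hωε2 : (ω * ε) ^ 2 ≤ p := by
    have : ω * ε ≤ 1 := hωε.trans hω6
    nlinarith [show 0 < ω * ε by positivity]
  have htp : t ≤ p * m := by nlinarith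
  have htm : t ≤ m := by nlinarith
  have hv : √((1 + t) / m) ≤ ω * ε := by
    rw [Real.sqrt_le_left (by positivity), div_le_iff₀ hm0]; linarith
  rcases lt_or_ge (d ^ 3) m with hdm | hdm
  · refine hlow d m n μ₀ μ₁ σ₁ t δ _ hμ hd hm hdm ht0 htm hδt ?_
    calc CE * √((1 + t) / m) ≤ CE * (ω * ε) := by gcongr
      _ = CE * ω * ε := by ring
      _ ≤ ε := mul_le_of_le_one_left hε.le hω1
  · have hdm' : (m : ℝ) ≤ (d : ℝ) ^ 3 := by exact_mod_cast hdm
    have hnpos : (0 : ℝ) < n := lt_of_lt_of_le (by positivity) hn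
    have hn1 : 1 ≤ n := by
      have : 0 < n := by exact_mod_cast hnpos
      omega
    -- In this regime the lower bound on m becomes one on d. Hence 1/d ≤ ωε, and the hypotheses on α
    -- and n make every error term O(ωε).
    have hdinv : 1 ≤ d * (ω * ε) := by
      have h1 : (1 : ℝ) ^ 3 ≤ (d * (ω * ε)) ^ 3 := by
        have h2 : m * ω ^ 3 * ε ^ 4 ≤ m * ω ^ 3 * ε ^ 3 :=
          mul_le_mul_of_nonneg_left (pow_le_pow_of_le_one hε.le hε1.le (by norm_num))
            (by positivity)
        calc (1 : ℝ) ^ 3 ≤ m * ω ^ 3 * ε ^ 3 := by linarith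
          _ ≤ (d : ℝ) ^ 3 * ω ^ 3 * ε ^ 3 := by gcongr
          _ = (d * (ω * ε)) ^ 3 := by ring
      exact le_of_pow_le_pow_left₀ (by norm_num) (by positivity) h1
    have hKα : K * α ≤ K * A / d := by
      calc K * α ≤ K * (A / d) := by gcongr
        _ = K * A / d := by ring
    have hn3 : B * (d : ℝ) ≤ n := by
      refine le_trans ?_ hn
      gcongr
      exact le_self_pow₀ hd1 (by norm_num)
    have hx : √((d + t) / n) ≤ √(2 / B) * (ω * ε) := by
      rw [Real.sqrt_le_left (by positivity), mul_pow, Real.sq_sqrt (by positivity),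
        div_le_iff₀ hnpos]
      have h1 : (d : ℝ) ≤ (d : ℝ) ^ 3 * (ω * ε) ^ 2 := by
        calc (d : ℝ) = d * 1 ^ 2 := by ring
          _ ≤ d * (d * (ω * ε)) ^ 2 := by gcongr
          _ = (d : ℝ) ^ 3 * (ω * ε) ^ 2 := by ring
      have h2 : t ≤ (d : ℝ) ^ 3 * (ω * ε) ^ 2 := by
        calc t ≤ m * (ω * ε) ^ 2 := by linarith
          _ ≤ (d : ℝ) ^ 3 * (ω * ε) ^ 2 := by gcongr
      calc d + t ≤ 2 / B * (ω * ε) ^ 2 * (B * (d : ℝ) ^ 3) := by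
            have : 2 / B * (ω * ε) ^ 2 * (B * (d : ℝ) ^ 3) = 2 * ((d : ℝ) ^ 3 * (ω * ε) ^ 2) := by
              field_simp
            linarith
        _ ≤ 2 / B * (ω * ε) ^ 2 * n := by gcongr
    have hinvd : 1 / (d : ℝ) ≤ ω * ε := by rw [div_le_iff₀ hd0]; linarith
    have hninv : 1 / (n : ℝ) ≤ 1 / B * (1 / d) := by
      rw [div_mul_div_comm, one_mul]; gcongr
    have hninv' : 1 / (n : ℝ) ≤ 1 / B * (ω * ε) := hninv.trans (by gcongr)
    have hKα' : K * α ≤ K * A * (ω * ε) := by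
      refine hKα.trans ?_
      rw [div_eq_mul_one_div]; gcongr
    set h := √((d + t) / n) + 1 / n + K * α with hh
    have hh0 : 0 ≤ h := by positivity
    have hsum : h ≤ ω * ε * G := by
      have : ω * ε * G = √(2 / B) * (ω * ε) + 1 / B * (ω * ε) + K * A * (ω * ε) := by
        rw [hG]; ring
      linarith
    have hωG : ω * ε * G ≤ ω * G := by gcongr
    have hx1 : √((d + t) / n) ≤ 1 := by
      have : √((d + t) / n) ≤ h := by
        have : 0 ≤ 1 / (n : ℝ) + K * α := by positivity
        linarith
      linarith
    -- The ratio d/m need not be bounded here. The factor d is cancelled by the decay of each term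
    -- of h in d, which leaves multiples of 1/m and √((1 + t)/m).
    have hhd : h * (d / m) ≤ ω * G := by
      have hinvm : 1 / (m : ℝ) ≤ ω := by
        have h1 : m * ω ^ 3 * ε ^ 4 ≤ m * ω := by
          calc m * ω ^ 3 * ε ^ 4 = m * ω * (ω ^ 2 * ε ^ 4) := by ring
            _ ≤ m * ω := mul_le_of_le_one_right (by positivity)
              (mul_le_one₀ hω2' (by positivity) (pow_le_one₀ hε.le hε1.le))
        rw [div_le_iff₀ hm0]; linarith
      have h1 : √((d + t) / n) * (d / m) ≤ √(2 / B) * ω := by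
        have h2 : √((d + t) / n) * d ≤ √(2 / B) * √((1 + t) * m) := by
          rw [← Real.sqrt_mul (by positivity)]
          apply Real.le_sqrt_of_sq_le
          rw [mul_pow, Real.sq_sqrt (by positivity), div_mul_eq_mul_div, div_le_iff₀ hnpos]
          have h3 : (d + t) * (d : ℝ) ^ 2 ≤ (1 + t) * (d : ℝ) ^ 3 := by
            have : (1 + t) * (d : ℝ) ^ 3 = (d + t * d) * (d : ℝ) ^ 2 := by ring
            rw [this]
            gcongr
            exact le_mul_of_one_le_right ht0 hd1
          calc (d + t) * (d : ℝ) ^ 2 ≤ (1 + t) * (d : ℝ) ^ 3 := h3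
            _ = 1 / B * ((1 + t) * 1) * (B * (d : ℝ) ^ 3) := by field_simp
            _ ≤ 2 / B * ((1 + t) * m) * n := by gcongr; norm_num
        have h3 : √((1 + t) * m) ≤ ω * m := by
          rw [Real.sqrt_le_left (by positivity)]
          have h4 : (ω * ε) ^ 2 ≤ ω ^ 2 := by gcongr
          calc (1 + t) * m ≤ m * ω ^ 2 * m := by
                gcongr; exact h1t.trans (by gcongr)
            _ = (ω * m) ^ 2 := by ring
        rw [← mul_div_assoc, div_le_iff₀ hm0]
        calc √((d + t) / n) * d ≤ √(2 / B) * √((1 + t) * m) := h2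
          _ ≤ √(2 / B) * (ω * m) := by gcongr
          _ = √(2 / B) * ω * m := by ring
      have h2 : 1 / (n : ℝ) * (d / m) ≤ 1 / B * ω := by
        calc 1 / (n : ℝ) * (d / m) ≤ 1 / B * (1 / d) * (d / m) := by gcongr
          _ = 1 / B * (1 / m) := by field_simp
          _ ≤ 1 / B * ω := by gcongr
      have h3 : K * α * (d / m) ≤ K * A * ω := by
        calc K * α * (d / m) ≤ K * A / d * (d / m) := by gcongr
          _ = K * A * (1 / m) := by field_simp
          _ ≤ K * A * ω := by gcongr
      calc h * (d / m) = √((d + t) / n) * (d / m) + 1 / (n : ℝ) * (d / m) + K * α * (d / m) := by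
            rw [hh]; ring
        _ ≤ √(2 / B) * ω + 1 / B * ω + K * A * ω := by linarith
        _ = ω * G := by rw [hG]; ring
    refine hhigh d m n μ₀ μ₁ σ₁ (K * α) t _ δ _ hμ hd hm hn1 hdm ht0
      (htp.trans (by gcongr)) hβ hσβ (hKα.trans (div_le_self (by positivity) hd1)) rfl hx1
      ?_ hδt ?_
    · have h1 : t / m ≤ 1 := by rw [div_le_one hm0]; exact htm
      have h2 : h * (t / m) ≤ h := mul_le_of_le_one_right hh0 h1
      calc h * (1 + (d + t) / m) = h + h * (d / m) + h * (t / m) := by ring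
        _ ≤ 3 * (ω * G) := by linarith
        _ ≤ cP := hω5
    · calc CP * h ≤ CP * (ω * ε * G) := by gcongr
        _ = CP * (ω * G) * ε := by ring
        _ ≤ ε := mul_le_of_le_one_left hε.le hω3

end RSS

theorem corollary1 :
    -- one rule that calculates the parameters of RSS training from the samples
    ∃ rule : RSS.ParamRule, (∀ (d m n : ℕ) (δ : ℝ), Measurable (rule d m n δ)) ∧
      -- implied constants may depend on `r = ‖μ₀‖`, `σ₀` and the constant `K` of the shift only
      ∀ r σ₀ K : ℝ, 0 ≤ r → 0 < σ₀ → 0 < K →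
        -- the dimension-dependent part `√(d / m)` of the ERM bound is beaten by any factor `c`
        (∃ C : ℝ, 0 < C ∧ ∀ c : ℝ, 0 < c → ∃ c₁ c₂ : ℝ, 0 < c₁ ∧ 0 < c₂ ∧
          ∀ (d m n : ℕ) (μ₀ μ₁ : RSS.E d) (σ₁ α δ : ℝ), 1 ≤ d → 1 ≤ m →
            ‖μ₀‖ = r → 0 ≤ σ₁ → 0 ≤ α → ‖μ₀ - μ₁‖ ≤ K * α → |σ₁ - σ₀| ≤ K * α →
            0 < δ → δ < 1 →
            α ≤ c₁ * ((d : ℝ) / m) → c₂ * ((m : ℝ) ^ 2 / d) ≤ n →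
            RSS.ExcessRiskBound rule m n μ₀ σ₀ μ₁ σ₁ δ
              (c * √((d : ℝ) / m) + C * √((1 + Real.log (1 / δ)) / m))) ∧
        -- a number of labeled points that does not depend on `d` suffices for excess risk `ε`
        (∀ A B : ℝ, 0 < A → 0 < B → ∃ C : ℝ, 0 < C ∧
          ∀ ε δ : ℝ, 0 < ε → 0 < δ → δ < 1 →
            ∀ (d m n : ℕ) (μ₀ μ₁ : RSS.E d) (σ₁ α : ℝ), 1 ≤ d → 1 ≤ m →
              ‖μ₀‖ = r → 0 ≤ σ₁ → 0 ≤ α → ‖μ₀ - μ₁‖ ≤ K * α → |σ₁ - σ₀| ≤ K * α →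
              α ≤ A / d → B * (d : ℝ) ^ 3 ≤ n →
              C * max (1 / ε ^ 4) (Real.log (1 / δ) / ε ^ 2) ≤ m →
              RSS.ExcessRiskBound rule m n μ₀ σ₀ μ₁ σ₁ δ ε) := by
  refine ⟨RSS.paramRule, RSS.measurable_paramRule, fun r σ₀ K hr hσ hK => ?_⟩
  rcases hr.eq_or_lt with rfl | hr
  · refine ⟨⟨1, one_pos, fun c hc => ⟨1, 1, one_pos, one_pos, ?_⟩⟩,
      fun A B _ _ => ⟨1, one_pos, ?_⟩⟩
    · intro d m n μ₀ μ₁ σ₁ α δ hd _ hμ _ _ _ _ _ _ _ _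
      exact RSS.excessRiskBound_of_norm_eq_zero hd hσ hμ (by positivity)
    · intro ε δ hε _ _ d m n μ₀ μ₁ σ₁ α hd _ hμ _ _ _ _ _ _ _
      exact RSS.excessRiskBound_of_norm_eq_zero hd hσ hμ hε.le
  · refine ⟨?_, fun A B hA hB => ?_⟩
    · obtain ⟨C, hC, h⟩ := RSS.exists_excessRiskBound_sqrt hr hσ hK
      refine ⟨C, hC, fun c hc => ?_⟩
      obtain ⟨c₁, c₂, hc₁, hc₂, h⟩ := h c hc
      exact ⟨c₁, c₂, hc₁, hc₂, fun d m n μ₀ μ₁ σ₁ α δ hd hm hμ _ => h d m n μ₀ μ₁ σ₁ α δ hd hm hμ⟩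
    · obtain ⟨C, hC, h⟩ := RSS.exists_excessRiskBound_dimension_free hr hσ hK hA hB
      exact ⟨C, hC, fun ε δ hε hδ hδ1 d m n μ₀ μ₁ σ₁ α hd hm hμ _ =>
        h ε δ hε hδ hδ1 d m n μ₀ μ₁ σ₁ α hd hm hμ⟩
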